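/- Let $m\ge 1$ and let $P,Q$ be $m\times m$ matrices of real rational functions of $z$, both proper, with $Q$ symmetric. Write $M^*$ for the conjugate transpose. Assume: (a) $P$ is discrete negative imaginary (D-NI): $P$ is analytic in $\{|z|>1\}$, and on this set $i[P(z)-P(z)^*]$ is positive semidefinite when $\operatorname{Im} z>0$, zero when $\operatorname{Im} z=0$, and negative semidefinite when $\operatorname{Im} z<0$; moreover $P$ has no poles at $+1$ and $-1$. (b) $Q$ is discrete weakly strictly negative imaginary (D-WSNI): all poles of $Q$ lie in $\{|z|<1\}$, and $i[Q(e^{i\theta})-Q(e^{i\theta})^*]$ is positive definite for all $\theta\in(0,\pi)$. (c) $P(-1)Q(-1)=0$ and $Q(-1)$ is positive semidefinite. Then all eigenvalues of $P(1)Q(1)$ are real, and, with $\bar\lambda$ denoting the largest eigenvalue, $$[P,Q]\ \text{is internally stable}\iff \bar\lambda\big(P(1)Q(1)\big)<1.$$ Here $[P,Q]$ is the positive feedback interconnection with two exogenous input signals $w_1,w_2:\{0,1,2,\dots\}\to\mathbb R^m$, $$e_1=w_1+Qe_2,\qquad e_2=w_2+Pe_1,$$ where a proper transfer function $G(z)=\sum_{k\ge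 0}G_kz^{-k}$ acts on signals by $(Gu)(k)=\sum_{l=0}^{k}G_{k-l}\,u(l)$. It is internally stable if it is well posed (all $w_1,w_2$ determine $e_1,e_2$ uniquely) and, for all $w_1,w_2$ of finite energy ($\sum_k|w(k)|^2<\infty$), the internal signals $e_1,e_2$ and the outputs $Pe_1,Qe_2$ have finite energy. -/

import Mathlib

open scoped Polynomial ComplexOrder

noncomputable section

/-- A square `m × m` real rational transfer function `G(z)`: a matrix of rational functions in the
indeterminate `z` with real coefficients. -/
abbrev TransferMatrix (m : ℕ) : Type := Matrix (Fin m) (Fin m) (RatFunc ℝ)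

namespace TransferMatrix

variable {m : ℕ}

/-- The value `G(z) ∈ ℂ^{m × m}` at a point `z` which is not a pole. -/
def valueAt (G : TransferMatrix m) (z : ℂ) : Matrix (Fin m) (Fin m) ℂ :=
  G.map (RatFunc.eval (algebraMap ℝ ℂ) z)

/-- `z` is a (finite) pole of `G`: the reduced denominator of some entry vanishes at `z`. -/
def IsPole (G : TransferMatrix m) (z : ℂ) : Prop :=
  ∃ i j, Polynomial.aeval z (G i j).denom = 0

/-- `G` is proper: no entry has a pole at infinity. -/
def IsProper (G : TransferMatrix m) : Prop :=
  ∀ i j, (G i j).num.degree ≤ (G i j).denom.degree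

/-- The Hermitian matrix `i [G(z) - G(z)^*]`. -/
def skewPart (G : TransferMatrix m) (z : ℂ) : Matrix (Fin m) (Fin m) ℂ :=
  Complex.I • (G.valueAt z - (G.valueAt z).conjTranspose)

/-- Discrete negative imaginary (D-NI), for real rational transfer functions. For a rational
function, being analytic in `|z| > 1` means having no poles there. -/
structure IsDNI (G : TransferMatrix m) : Prop where
  analytic : ∀ z : ℂ, 1 < ‖z‖ → ¬ G.IsPole z
  upper : ∀ z : ℂ, 1 < ‖z‖ → 0 < z.im → (G.skewPart z).PosSemidef
  real : ∀ z : ℂ, 1 < ‖z‖ → z.im = 0 → G.skewPart z = 0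
  lower : ∀ z : ℂ, 1 < ‖z‖ → z.im < 0 → (-G.skewPart z).PosSemidef

/-- Discrete weakly strictly negative imaginary (D-WSNI), for real rational transfer functions. -/
structure IsDWSNI (G : TransferMatrix m) : Prop where
  poles : ∀ z : ℂ, G.IsPole z → ‖z‖ < 1
  circle : ∀ θ : ℝ, θ ∈ Set.Ioo 0 Real.pi →
    (G.skewPart (Complex.exp ((θ : ℂ) * Complex.I))).PosDef

/-- A discrete-time signal on `k = 0, 1, 2, …` with values in `ℝ^m`. -/
abbrev Signal (m : ℕ) : Type := ℕ → Fin m → ℝ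

/-- Finite energy: `∑ₖ |u(k)|² < ∞`. -/
def FiniteEnergy (u : Signal m) : Prop :=
  Summable fun k => ∑ i, u k i ^ 2

/-- The impulse response `h(0), h(1), …` of a proper rational function `f`, i.e. the coefficients
of its expansion `f(z) = ∑ₖ h(k) z⁻ᵏ` at infinity. With `n = deg (denom f)` and `x = 1 / z`, one
has `f = (xⁿ num(1/x)) / (xⁿ denom(1/x))`; the constant term of `xⁿ denom(1/x)` is nonzero. -/
def impulseResponse (f : RatFunc ℝ) (k : ℕ) : ℝ :=
  PowerSeries.coeff k
    (((f.num.reflect f.denom.natDegree : ℝ[X]) : PowerSeries ℝ) *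
      ((f.denom.reverse : ℝ[X]) : PowerSeries ℝ)⁻¹)

/-- The output of the causal system (at rest before time `0`) with proper transfer function `G` for
the input `u`: convolution with the impulse response of `G`. -/
def output (G : TransferMatrix m) (u : Signal m) : Signal m :=
  fun k i => ∑ j, ∑ l ∈ Finset.range (k + 1), impulseResponse (G i j) (k - l) * u l j

/-- The equations of the positive feedback interconnection `[P, Q]` with exogenous signals
`w₁, w₂` added at the inputs of `P` and `Q`: the input `e₁` of `P` is `w₁` plus the output of `Q`,
and the input `e₂` of `Q` is `w₂` plus the output of `P`. -/
def IsLoopSolution (P Q : TransferMatrix m) (w₁ w₂ e₁ e₂ : Signal m) : Prop :=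
  e₁ = w₁ + Q.output e₂ ∧ e₂ = w₂ + P.output e₁

/-- Internal stability of the positive feedback interconnection `[P, Q]`: it is well posed (all
exogenous signals determine the internal signals uniquely), and for all exogenous signals of finite
energy, all internal and output signals have finite energy. -/
def InternallyStable (P Q : TransferMatrix m) : Prop :=
  (∀ w₁ w₂ : Signal m, ∃! e : Signal m × Signal m, IsLoopSolution P Q w₁ w₂ e.1 e.2) ∧
  ∀ w₁ w₂ e₁ e₂ : Signal m, FiniteEnergy w₁ → FiniteEnergy w₂ →
    IsLoopSolution P Q w₁ w₂ e₁ e₂ →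
      FiniteEnergy e₁ ∧ FiniteEnergy e₂ ∧ FiniteEnergy (P.output e₁) ∧ FiniteEnergy (Q.output e₂)

end TransferMatrix

/-- All (complex) eigenvalues of the square matrix `A` are real. -/
def HasOnlyRealEigenvalues {m : ℕ} (A : Matrix (Fin m) (Fin m) ℂ) : Prop :=
  ∀ μ ∈ spectrum ℂ A, μ.im = 0

/-- The largest eigenvalue of a nonempty square matrix that has only real eigenvalues. -/
def largestEigenvalue {m : ℕ} (A : Matrix (Fin m) (Fin m) ℂ) : ℝ :=
  sSup {x : ℝ | (x : ℂ) ∈ spectrum ℂ A}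

end

/-! Put `x = 1/z`, so that the exterior of the unit disc becomes the disc, the upper half plane
becomes the lower one, and the impulse response becomes the Taylor series at `x = 0`. Write `P(x)`,
`Q(x)` for the values in this variable.

Monotonicity. For a fixed vector `v` the forms `v^*P(x)v` and `v^*Q(x)v` are real on `[-1,1]` and
have imaginary part `≤ 0` on the lower half disc; for `Q` and `v ≠ 0` it is `< 0` by the maximum
principle. By Cauchy–Riemann they increase on `[-1,1]`, strictly for `Q`. As `Q(-1) ≥ 0`, this makes
`Q(x)` positive definite on `(-1,1]`.

Stability. The claim is that stability holds iff `det(I - P(x)Q(x)) ≠ 0` for all `x` in `[-1,1]`. A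
nonreal point of the closed disc is never a closed-loop pole: there the imaginary parts of the forms
give an energy estimate that bounds the loop along the radius (`Matrix.norm_le_of_loop`). This also
copes with poles of `P` on the circle. Without poles in the closed disc the closed-loop impulse
responses are absolutely summable, and convolution with them preserves finite energy
(`internallyStable_of_absSummable`). Conversely, a real zero of the determinant gives an impulse
whose response has infinite energy (`InternallyStable.eval_det_loopMatrix_ne_zero`).

Eigenvalues. Let `H = Q - QPQ = Q(I - PQ)`. When `Q > 0`, the eigenvalues of `PQ` are real, and they
are all `< 1` iff `H > 0`. If `H(1) > 0`, then `P(x) ≤ P(1)` and `Q(x) ≤ Q(1)` keep `I - P(x)Q(x)`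
nonsingular. If the loop is stable, then `H > 0` near `x = -1`, where `PQ` is small, and `H` stays
nonsingular, hence positive definite, up to `x = 1`. -/

/-! ### Power series with absolutely summable coefficients -/

namespace PowerSeries

/-- The coefficients of `f` are absolutely summable. -/
def AbsSummable {R : Type*} [NormedRing R] (f : PowerSeries R) : Prop :=
  Summable fun k => ‖coeff k f‖

namespace AbsSummable

lemma mul {R : Type*} [NormedRing R] {f g : PowerSeries R} (hf : f.AbsSummable)
    (hg : g.AbsSummable) : (f * g).AbsSummable := by
  unfold AbsSummable
  simpa only [coeff_mul] using summable_norm_sum_mul_antidiagonal_of_summable_norm hf hg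

lemma coe {R : Type*} [NormedRing R] (p : R[X]) : (p : PowerSeries R).AbsSummable := by
  refine summable_of_ne_finset_zero (s := p.support) fun k hk => ?_
  rw [Polynomial.coeff_coe, Polynomial.notMem_support_iff.1 hk, norm_zero]

lemma inv_one_sub_C_mul_X {r : ℂ} (hr : ‖r‖ < 1) :
    ((1 - C r * X : PowerSeries ℂ)⁻¹).AbsSummable := by
  have h : (1 - C r * X : PowerSeries ℂ)⁻¹ = PowerSeries.mk fun k => r ^ k := by
    rw [PowerSeries.inv_eq_iff_mul_eq_one (by simp)]
    ext k
    rw [mul_sub, mul_one, map_sub, mul_comm (C r), ← mul_assoc]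
    cases k with
    | zero => simp
    | succ k => simp [coeff_succ_mul_X, coeff_one, pow_succ]
  unfold AbsSummable
  simpa [h] using summable_geometric_of_lt_one (norm_nonneg r) hr

lemma inv_X_sub_C {r : ℂ} (hr : 1 < ‖r‖) :
    (((Polynomial.X - Polynomial.C r : ℂ[X]) : PowerSeries ℂ)⁻¹).AbsSummable := by
  have hr0 : r ≠ 0 := by rintro rfl; norm_num at hr
  have h : ((Polynomial.X - Polynomial.C r : ℂ[X]) : PowerSeries ℂ) =
      C (-r) * (1 - C r⁻¹ * X) := by
    rw [mul_sub, mul_one, ← mul_assoc, ← map_mul, Polynomial.coe_sub, Polynomial.coe_X,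
      Polynomial.coe_C, neg_mul, mul_inv_cancel₀ hr0]
    simp
    ring
  rw [h, PowerSeries.mul_inv_rev]
  refine mul (inv_one_sub_C_mul_X ?_) ?_
  · rw [norm_inv]; exact inv_lt_one_of_one_lt₀ hr
  · rw [PowerSeries.C_inv, ← Polynomial.coe_C]
    exact coe _

/-- Over `ℂ` the polynomial splits, so its inverse is a constant times a product of geometric series
of ratios `1/r`, with `r` running over the roots, all outside the closed disc. -/
lemma inv_of_no_root (p : ℂ[X]) (hp : ∀ x : ℂ, ‖x‖ ≤ 1 → p.eval x ≠ 0) :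
    ((p : PowerSeries ℂ)⁻¹).AbsSummable := by
  have key : ∀ s : Multiset ℂ, (∀ r ∈ s, 1 < ‖r‖) →
      ((((s.map fun x => Polynomial.X - Polynomial.C x).prod : ℂ[X]) :
        PowerSeries ℂ)⁻¹).AbsSummable := by
    intro s
    induction s using Multiset.induction with
    | empty =>
      intro _
      have := coe (1 : ℂ[X])
      simpa using this
    | cons a s ih =>
      intro h
      rw [Multiset.map_cons, Multiset.prod_cons, Polynomial.coe_mul, PowerSeries.mul_inv_rev]
      exact mul (ih fun r hr => h r (Multiset.mem_cons_of_mem hr))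
        (inv_X_sub_C (h a (Multiset.mem_cons_self a s)))
  rw [(IsAlgClosed.splits p).eq_prod_roots, Polynomial.coe_mul, PowerSeries.mul_inv_rev]
  refine mul (key _ fun r hr => ?_) ?_
  · by_contra hle
    exact hp r (not_lt.1 hle) (Polynomial.isRoot_of_mem_roots hr)
  · rw [Polynomial.coe_C, PowerSeries.C_inv, ← Polynomial.coe_C]
    exact coe _

lemma of_map_complex {f : PowerSeries ℝ}
    (hf : (PowerSeries.map (algebraMap ℝ ℂ) f).AbsSummable) : f.AbsSummable := by
  unfold AbsSummable at hf ⊢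
  simpa using hf

/-- A quotient of real polynomials whose denominator has no root in the closed unit disc. -/
lemma mul_inv_of_no_root (a b : ℝ[X]) (hb : ∀ x : ℂ, ‖x‖ ≤ 1 → b.aeval x ≠ 0) :
    ((a : PowerSeries ℝ) * (b : PowerSeries ℝ)⁻¹).AbsSummable := by
  refine mul (coe a) (of_map_complex ?_)
  have h0 : constantCoeff (b : PowerSeries ℝ) ≠ 0 := by
    intro h
    apply hb 0 (by simp)
    rw [Polynomial.aeval_def, Polynomial.eval₂_at_zero]
    simpa using h
  have h : PowerSeries.map (algebraMap ℝ ℂ) (b : PowerSeries ℝ)⁻¹ =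
      ((b.map (algebraMap ℝ ℂ) : ℂ[X]) : PowerSeries ℂ)⁻¹ := by
    rw [eq_comm, PowerSeries.inv_eq_iff_mul_eq_one, Polynomial.polynomial_map_coe, ← map_mul,
      PowerSeries.inv_mul_cancel _ h0, map_one]
    rw [Polynomial.constantCoeff_coe] at h0 ⊢
    simpa using h0
  rw [h]
  refine inv_of_no_root _ fun x hx => ?_
  rw [Polynomial.eval_map_algebraMap]
  exact hb x hx

open Filter Topology in
/-- A quotient `a / b` of real polynomials which is radially bounded at every root of `b` in the
closed unit disc with nonpositive imaginary part. -/
lemma mul_inv_of_radially_bounded (a b : ℝ[X]) (hb0 : b.coeff 0 ≠ 0)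
    (hb : ∀ x : ℂ, ‖x‖ ≤ 1 → x.im ≤ 0 → b.aeval x = 0 →
      ∃ K : ℝ, ∀ᶠ t : ℝ in 𝓝[<] 1, ‖a.aeval (t * x)‖ ≤ K * ‖b.aeval (t * x)‖) :
    ((a : PowerSeries ℝ) * (b : PowerSeries ℝ)⁻¹).AbsSummable := by
  have hbne : b ≠ 0 := by rintro rfl; simp at hb0
  -- Roots of `b` may cancel against `a`, so poles are excluded for the reduced fraction `a' / b'`:
  -- at a root of `b'` the radial bound forces `a'` to vanish too, contradicting coprimality.
  set g := gcd a b with hg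
  obtain ⟨a', ha'⟩ : g ∣ a := gcd_dvd_left a b
  obtain ⟨b', hb'⟩ : g ∣ b := gcd_dvd_right a b
  have hg0 : g ≠ 0 := by intro h; rw [h, zero_mul] at hb'; exact hbne hb'
  have hcop : IsCoprime a' b' := by
    have := isCoprime_div_gcd_div_gcd (p := a) hbne
    rw [← hg] at this
    rwa [show a / g = a' by rw [ha', mul_div_cancel_left₀ _ hg0],
      show b / g = b' by rw [hb', mul_div_cancel_left₀ _ hg0]] at this
  have hgc : g.coeff 0 ≠ 0 ∧ b'.coeff 0 ≠ 0 := by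
    rw [hb', Polynomial.mul_coeff_zero] at hb0
    exact ⟨left_ne_zero_of_mul hb0, right_ne_zero_of_mul hb0⟩
  have hquot : (a : PowerSeries ℝ) * (b : PowerSeries ℝ)⁻¹ =
      (a' : PowerSeries ℝ) * (b' : PowerSeries ℝ)⁻¹ := by
    rw [ha', hb', Polynomial.coe_mul, Polynomial.coe_mul, PowerSeries.mul_inv_rev]
    have : (g : PowerSeries ℝ) * (g : PowerSeries ℝ)⁻¹ = 1 :=
      PowerSeries.mul_inv_cancel _ (by simpa using hgc.1)
    linear_combination ((a' : PowerSeries ℝ) * (b' : PowerSeries ℝ)⁻¹) * this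
  rw [hquot]
  have key : ∀ x : ℂ, ‖x‖ ≤ 1 → x.im ≤ 0 → b'.aeval x ≠ 0 := by
    intro x hx him hroot
    obtain ⟨K, hK⟩ := hb x hx him (by rw [hb', map_mul, hroot, mul_zero])
    have hx0 : x ≠ 0 := by
      rintro rfl
      rw [Polynomial.aeval_def, Polynomial.eval₂_at_zero] at hroot
      exact hgc.2 (by simpa using hroot)
    -- The ray meets only finitely many zeros of `g`, so `g` can be divided out of the bound for `t
    -- < 1` close to `1`.
    have hgne : ∀ᶠ t : ℝ in 𝓝[<] 1, g.aeval (t * x) ≠ 0 := by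
      have hfin : {t : ℝ | g.aeval ((t : ℂ) * x) = 0}.Finite := by
        have h1 : ((g.map (algebraMap ℝ ℂ)).rootSet ℂ).Finite := Polynomial.rootSet_finite _ _
        refine (h1.preimage (f := fun t : ℝ => (t : ℂ) * x) ?_).subset ?_
        · intro s _ t _ hst
          exact_mod_cast mul_right_cancel₀ hx0 hst
        · intro t ht
          rw [Set.mem_preimage, Polynomial.mem_rootSet]
          exact ⟨(Polynomial.map_ne_zero_iff (algebraMap ℝ ℂ).injective).2 hg0, by simpa using ht⟩
      have h2 : ({t : ℝ | g.aeval ((t : ℂ) * x) = 0} \ {1})ᶜ ∈ 𝓝 (1 : ℝ) :=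
        (hfin.subset Set.sdiff_subset).isClosed.isOpen_compl.mem_nhds (by simp)
      filter_upwards [nhdsWithin_le_nhds h2, self_mem_nhdsWithin] with t ht ht1 h0
      exact ht ⟨h0, ne_of_lt ht1⟩
    have hle : ∀ᶠ t : ℝ in 𝓝[<] 1, ‖a'.aeval (t * x)‖ ≤ K * ‖b'.aeval (t * x)‖ := by
      filter_upwards [hK, hgne] with t ht hgt
      rw [ha', hb', map_mul, map_mul, norm_mul, norm_mul] at ht
      have hpos : 0 < ‖g.aeval (t * x)‖ := norm_pos_iff.2 hgt
      nlinarith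
    have hlim : ∀ p : ℝ[X], Tendsto (fun t : ℝ => ‖p.aeval (t * x)‖) (𝓝[<] 1)
        (𝓝 ‖p.aeval x‖) := by
      intro p
      have hc : Continuous fun t : ℝ => ‖p.aeval ((t : ℂ) * x)‖ := by fun_prop
      have := (hc.tendsto 1).mono_left (nhdsWithin_le_nhds (s := Set.Iio 1))
      simpa using this
    have h3 : ‖a'.aeval x‖ ≤ K * ‖b'.aeval x‖ :=
      le_of_tendsto_of_tendsto (hlim a') ((hlim b').const_mul K) hle
    rw [hroot, norm_zero, mul_zero] at h3
    have ha0 : a'.aeval x = 0 := norm_le_zero_iff.1 h3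
    obtain ⟨u, v, huv⟩ := hcop
    have := congrArg (Polynomial.aeval x) huv
    simp [ha0, hroot] at this
  refine mul_inv_of_no_root a' b' fun x hx hroot => ?_
  rcases le_total x.im 0 with h | h
  · exact key x hx h hroot
  -- The coefficients are real, so a root in the upper half disc has its conjugate in the lower one.
  · refine key (starRingEnd ℂ x) (by simpa using hx) (by simpa using h) ?_
    rw [Polynomial.aeval_conj, hroot, map_zero]

end AbsSummable

/-- Convolution of a summable with a square summable sequence is square summable. -/
lemma AbsSummable.summable_sq_coeff_mul {h u : PowerSeries ℝ} (hh : h.AbsSummable)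
    (hu : Summable fun k => coeff k u ^ 2) : Summable fun k => coeff k (h * u) ^ 2 := by
  have hconv : Summable fun n => ‖∑ kl ∈ Finset.HasAntidiagonal.antidiagonal n,
      |coeff kl.1 h| * coeff kl.2 u ^ 2‖ :=
    summable_norm_sum_mul_antidiagonal_of_summable_norm (f := fun k => |coeff k h|)
      (g := fun k => coeff k u ^ 2) (by simpa [AbsSummable] using hh) (by simpa using hu)
  refine Summable.of_nonneg_of_le (fun k => sq_nonneg _) (fun k => ?_)
    (hconv.mul_left (∑' k, ‖coeff k h‖))
  rw [coeff_mul]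
  -- Cauchy–Schwarz with the weights `|h|`; the first factor is at most the total `ℓ¹` mass, the
  -- second is a convolution of two summable sequences.
  have h1 : (∑ kl ∈ Finset.HasAntidiagonal.antidiagonal k, coeff kl.1 h * coeff kl.2 u) ^ 2 ≤
      (∑ kl ∈ Finset.HasAntidiagonal.antidiagonal k, |coeff kl.1 h|) *
        ∑ kl ∈ Finset.HasAntidiagonal.antidiagonal k, |coeff kl.1 h| * coeff kl.2 u ^ 2 := by
    refine Finset.sum_sq_le_sum_mul_sum_of_sq_le_mul _ (fun _ _ => abs_nonneg _)
      (fun _ _ => by positivity) fun _ _ => ?_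
    rw [← mul_assoc, abs_mul_abs_self, mul_pow, sq (coeff _ h)]
  refine h1.trans (mul_le_mul ?_ (le_abs_self _) (Finset.sum_nonneg fun _ _ => by positivity)
    (tsum_nonneg fun _ => norm_nonneg _))
  rw [Finset.Nat.sum_antidiagonal_eq_sum_range_succ_mk]
  exact hh.sum_le_tsum (Finset.range k.succ) (fun _ _ => abs_nonneg _)

end PowerSeries

/-! ### Transfer matrices in the variable `x = 1/z` and generating functions of signals -/

namespace TransferMatrix
variable {m : ℕ}

/-- The numerator of `f (1 / x)` as a polynomial in `x`, for proper `f`. -/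
noncomputable def recipNum (f : RatFunc ℝ) : ℝ[X] := f.num.reflect f.denom.natDegree

/-- The denominator of `f (1 / x)` as a polynomial in `x`, for proper `f`. -/
noncomputable def recipDen (f : RatFunc ℝ) : ℝ[X] := f.denom.reverse

/-- The value of `G` at `z = 1 / x`, extended to `x = 0`. -/
noncomputable def recipAt (G : TransferMatrix m) (x : ℂ) : Matrix (Fin m) (Fin m) ℂ :=
  fun i j => (recipNum (G i j)).aeval x / (recipDen (G i j)).aeval x

/-- `1 / x` is not a pole of `G`. -/
def RegularAt (G : TransferMatrix m) (x : ℂ) : Prop :=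
  ∀ i j, (recipDen (G i j)).aeval x ≠ 0

/-- Reversal turns the leading coefficient of the monic denominator into the constant term. Hence `x
= 0`, that is `z = ∞`, is always regular and the denominator is invertible as a power series. -/
lemma recipDen_coeff_zero (f : RatFunc ℝ) : (recipDen f).coeff 0 = 1 := by
  rw [recipDen, Polynomial.coeff_zero_reverse]
  exact f.monic_denom

lemma regularAt_zero (G : TransferMatrix m) : G.RegularAt 0 := by
  intro i j
  rw [Polynomial.aeval_def, Polynomial.eval₂_at_zero, recipDen_coeff_zero]
  simp

lemma aeval_recipDen_mul_pow (f : RatFunc ℝ) {z : ℂ} (hz : z ≠ 0) :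
    (recipDen f).aeval z⁻¹ * z ^ f.denom.natDegree = f.denom.aeval z := by
  let _ := invertibleOfNonzero hz
  have := Polynomial.eval₂_reverse_mul_pow (algebraMap ℝ ℂ) z f.denom
  rwa [invOf_eq_inv] at this

lemma aeval_recipNum_mul_pow (f : RatFunc ℝ) (hf : f.num.degree ≤ f.denom.degree) {z : ℂ}
    (hz : z ≠ 0) : (recipNum f).aeval z⁻¹ * z ^ f.denom.natDegree = f.num.aeval z := by
  let _ := invertibleOfNonzero hz
  have := Polynomial.eval₂_reflect_mul_pow (algebraMap ℝ ℂ) z f.denom.natDegree f.num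
    (Polynomial.natDegree_le_natDegree hf)
  rwa [invOf_eq_inv] at this

lemma regularAt_inv {G : TransferMatrix m} {z : ℂ} (hz : z ≠ 0) (h : ¬ G.IsPole z) :
    G.RegularAt z⁻¹ := by
  intro i j h0
  refine h ⟨i, j, ?_⟩
  rw [← aeval_recipDen_mul_pow _ hz, h0, zero_mul]

lemma regularAt_of_ne_zero {G : TransferMatrix m} {x : ℂ} (hx : x ≠ 0) (h : ¬ G.IsPole x⁻¹) :
    G.RegularAt x := by
  simpa using regularAt_inv (inv_ne_zero hx) h

lemma recipAt_inv {G : TransferMatrix m} (hG : G.IsProper) {z : ℂ} (hz : z ≠ 0) :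
    G.recipAt z⁻¹ = G.valueAt z := by
  ext i j
  rw [valueAt, Matrix.map_apply, RatFunc.eval, ← Polynomial.aeval_def, ← Polynomial.aeval_def,
    ← aeval_recipDen_mul_pow _ hz, ← aeval_recipNum_mul_pow _ (hG i j) hz,
    mul_div_mul_right _ _ (pow_ne_zero _ hz)]
  rfl

lemma recipAt_eq {G : TransferMatrix m} (hG : G.IsProper) {x : ℂ} (hx : x ≠ 0) :
    G.recipAt x = G.valueAt x⁻¹ := by
  simpa using recipAt_inv hG (inv_ne_zero hx)

lemma differentiableAt_recipAt {G : TransferMatrix m} {x : ℂ} (hx : G.RegularAt x) (i j : Fin m) :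
    DifferentiableAt ℂ (fun y => G.recipAt y i j) x :=
  DifferentiableAt.fun_div (Polynomial.differentiable_aeval _ _)
    (Polynomial.differentiable_aeval _ _) (hx i j)

lemma continuousAt_recipAt {G : TransferMatrix m} {x : ℂ} (hx : G.RegularAt x) :
    ContinuousAt G.recipAt x :=
  continuousAt_pi.2 fun i => continuousAt_pi.2 fun j =>
    (differentiableAt_recipAt hx i j).continuousAt

/-- A common denominator in the variable `x = 1 / z`. -/
noncomputable def commonDen (G : TransferMatrix m) : ℝ[X] := ∏ i, ∏ j, recipDen (G i j)

/-- The numerators over the common denominator `commonDen G`. -/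
noncomputable def commonNum (G : TransferMatrix m) : Matrix (Fin m) (Fin m) ℝ[X] :=
  fun i j => recipNum (G i j) * (G.commonDen / recipDen (G i j))

lemma recipDen_ne_zero (f : RatFunc ℝ) : recipDen f ≠ 0 := by
  intro h
  have := recipDen_coeff_zero f
  simp [h] at this

lemma commonNum_mul_recipDen (G : TransferMatrix m) (i j : Fin m) :
    G.commonNum i j * recipDen (G i j) = recipNum (G i j) * G.commonDen := by
  have hdvd : recipDen (G i j) ∣ G.commonDen :=
    (Finset.dvd_prod_of_mem (fun j => recipDen (G i j)) (Finset.mem_univ j)).trans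
      (Finset.dvd_prod_of_mem (fun i => ∏ j, recipDen (G i j)) (Finset.mem_univ i))
  rw [commonNum, mul_assoc, mul_comm (_ / _), EuclideanDomain.mul_div_cancel' (recipDen_ne_zero _)
    hdvd]

lemma aeval_commonDen_ne_zero {G : TransferMatrix m} {x : ℂ} (hx : G.RegularAt x) :
    G.commonDen.aeval x ≠ 0 := by
  simp only [commonDen, map_prod]
  exact Finset.prod_ne_zero_iff.2 fun i _ => Finset.prod_ne_zero_iff.2 fun j _ => hx i j

lemma aeval_commonNum {G : TransferMatrix m} {x : ℂ} (hx : G.RegularAt x) (i j : Fin m) :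
    (G.commonNum i j).aeval x = G.commonDen.aeval x * G.recipAt x i j := by
  have := congrArg (Polynomial.aeval x) (G.commonNum_mul_recipDen i j)
  rw [map_mul, map_mul] at this
  rw [recipAt, mul_div_assoc', eq_div_iff (hx i j), this, mul_comm]

/-- The matrix of expansions of the entries of `G` in powers of `x = 1 / z`. -/
noncomputable def impulseMatrix (G : TransferMatrix m) : Matrix (Fin m) (Fin m) (PowerSeries ℝ) :=
  fun i j => (recipNum (G i j) : PowerSeries ℝ) * (recipDen (G i j) : PowerSeries ℝ)⁻¹

/-- The power series counterpart of `aeval_commonNum`. The same polynomials govern the values of `G`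
and its impulse response, which links function theory to signals. -/
lemma commonDen_mul_impulseMatrix (G : TransferMatrix m) (i j : Fin m) :
    (G.commonDen : PowerSeries ℝ) * G.impulseMatrix i j = (G.commonNum i j : PowerSeries ℝ) := by
  have h := congrArg (fun p : ℝ[X] => (p : PowerSeries ℝ)) (G.commonNum_mul_recipDen i j)
  simp only [Polynomial.coe_mul] at h
  have hinv : (recipDen (G i j) : PowerSeries ℝ) * (recipDen (G i j) : PowerSeries ℝ)⁻¹ = 1 :=
    PowerSeries.mul_inv_cancel _ (by simp [recipDen_coeff_zero])
  rw [impulseMatrix]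
  linear_combination (-(recipDen (G i j) : PowerSeries ℝ)⁻¹) * h +
    (G.commonNum i j : PowerSeries ℝ) * hinv

/-- The generating functions of the components of a signal. -/
noncomputable def genFun (u : Signal m) : Fin m → PowerSeries ℝ := fun i => PowerSeries.mk fun k => u k i

lemma genFun_add (u v : Signal m) : genFun (u + v) = genFun u + genFun v := by
  ext i k
  simp [genFun]

lemma genFun_injective : Function.Injective (genFun (m := m)) := by
  intro u v h
  ext k i
  simpa [genFun] using congrArg (PowerSeries.coeff k) (congrFun h i)

lemma genFun_surjective : Function.Surjective (genFun (m := m)) := fun f =>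
  ⟨fun k i => PowerSeries.coeff k (f i), by ext i k; simp [genFun]⟩

lemma genFun_output (G : TransferMatrix m) (u : Signal m) :
    genFun (G.output u) = G.impulseMatrix.mulVec (genFun u) := by
  ext i k
  rw [Matrix.mulVec, dotProduct, map_sum]
  simp only [genFun, PowerSeries.coeff_mk, output]
  refine Finset.sum_congr rfl fun j _ => ?_
  rw [mul_comm (G.impulseMatrix i j), PowerSeries.coeff_mul,
    Finset.Nat.sum_antidiagonal_eq_sum_range_succ_mk]
  refine Finset.sum_congr rfl fun l _ => ?_
  rw [PowerSeries.coeff_mk, mul_comm]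
  rfl

lemma isLoopSolution_iff (P Q : TransferMatrix m) (w₁ w₂ e₁ e₂ : Signal m) :
    IsLoopSolution P Q w₁ w₂ e₁ e₂ ↔
      genFun e₁ = genFun w₁ + Q.impulseMatrix.mulVec (genFun e₂) ∧
      genFun e₂ = genFun w₂ + P.impulseMatrix.mulVec (genFun e₁) := by
  rw [IsLoopSolution, ← genFun_output, ← genFun_output, ← genFun_add, ← genFun_add,
    genFun_injective.eq_iff, genFun_injective.eq_iff]

lemma finiteEnergy_iff (u : Signal m) :
    FiniteEnergy u ↔ ∀ i, Summable fun k => PowerSeries.coeff k (genFun u i) ^ 2 := by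
  simp only [genFun, PowerSeries.coeff_mk]
  constructor
  · intro h i
    exact Summable.of_nonneg_of_le (fun _ => sq_nonneg _) (fun k =>
      Finset.single_le_sum (f := fun i => u k i ^ 2) (fun _ _ => sq_nonneg _)
        (Finset.mem_univ i)) h
  · exact fun h => summable_sum fun i _ => h i

/-- The return difference `I - P Q` cleared of denominators, in the variable `x = 1 / z`. -/
noncomputable def loopMatrix (P Q : TransferMatrix m) : Matrix (Fin m) (Fin m) ℝ[X] :=
  (P.commonDen * Q.commonDen) • (1 : Matrix (Fin m) (Fin m) ℝ[X]) - P.commonNum * Q.commonNum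

lemma loopMatrix_map_aeval {P Q : TransferMatrix m} {x : ℂ} (hP : P.RegularAt x)
    (hQ : Q.RegularAt x) : (loopMatrix P Q).map (Polynomial.aeval x) =
      ((P.commonDen * Q.commonDen).aeval x) • (1 - P.recipAt x * Q.recipAt x) := by
  ext i j
  simp only [loopMatrix, Matrix.map_apply, Matrix.sub_apply, Matrix.smul_apply, Matrix.mul_apply,
    map_sub, map_sum, map_mul, aeval_commonNum hP, aeval_commonNum hQ, smul_eq_mul, mul_sub,
    Finset.mul_sum]
  congr 1
  · rw [Matrix.one_apply, Matrix.one_apply]; split_ifs <;> simp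
  · exact Finset.sum_congr rfl fun l _ => by ring

lemma aeval_det_loopMatrix {P Q : TransferMatrix m} {x : ℂ} (hP : P.RegularAt x)
    (hQ : Q.RegularAt x) : (loopMatrix P Q).det.aeval x =
      ((P.commonDen * Q.commonDen).aeval x) ^ m * (1 - P.recipAt x * Q.recipAt x).det := by
  have := congrArg Matrix.det (loopMatrix_map_aeval hP hQ)
  rw [Matrix.det_smul, Fintype.card_fin] at this
  rw [← this, AlgHom.map_det]
  rfl

lemma aeval_det_loopMatrix_eq_zero_iff {P Q : TransferMatrix m} {x : ℂ} (hP : P.RegularAt x)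
    (hQ : Q.RegularAt x) : (loopMatrix P Q).det.aeval x = 0 ↔
      (1 - P.recipAt x * Q.recipAt x).det = 0 := by
  rw [aeval_det_loopMatrix hP hQ, mul_eq_zero_iff_left (pow_ne_zero _ ?_)]
  rw [map_mul]
  exact mul_ne_zero (aeval_commonDen_ne_zero hP) (aeval_commonDen_ne_zero hQ)

/-- The entries of a polynomial matrix as power series. -/
noncomputable def toSeries (A : Matrix (Fin m) (Fin m) ℝ[X]) : Matrix (Fin m) (Fin m) (PowerSeries ℝ) :=
  A.map (Polynomial.coeToPowerSeries.ringHom (R := ℝ))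

lemma toSeries_loopMatrix (P Q : TransferMatrix m) : toSeries (loopMatrix P Q) =
    ((P.commonDen * Q.commonDen : ℝ[X]) : PowerSeries ℝ) •
      (1 - P.impulseMatrix * Q.impulseMatrix) := by
  ext1 i j
  simp only [toSeries, loopMatrix, Matrix.map_apply, Matrix.sub_apply, Matrix.smul_apply,
    Matrix.mul_apply, map_sub, map_sum, map_mul, smul_eq_mul, mul_sub, Finset.mul_sum,
    Polynomial.coeToPowerSeries.ringHom_apply, ← commonDen_mul_impulseMatrix, Polynomial.coe_mul]
  congr 1
  · rw [Matrix.one_apply, Matrix.one_apply]; split_ifs <;> simp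
  · exact Finset.sum_congr rfl fun l _ => by ring

end TransferMatrix

/-! ### The closed loop on signals of finite energy -/

open Filter Topology in
/-- A power series with square summable coefficients has no pole in the closed unit disc. -/
lemma PowerSeries.eval_eq_zero_of_X_sub_C_mul {F : PowerSeries ℝ} {r : ℝ[X]} {x : ℝ}
    (hx : |x| ≤ 1) (hF : Summable fun k => coeff k F ^ 2)
    (h : ((Polynomial.X - Polynomial.C x : ℝ[X]) : PowerSeries ℝ) * F = r) : r.eval x = 0 := by
  -- Comparing coefficients in `(X - x) F = r` and summing with weights `x ^ k` telescopes. Once `n`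
  -- reaches the degree of `r`, the right side is `-r(x)`, while `|x| ≤ 1` and the coefficients of
  -- `F` tend to zero.
  have hrec : ∀ n, x ^ (n + 1) * coeff n F = -∑ k ∈ Finset.range (n + 1), r.coeff k * x ^ k := by
    have hc : ∀ k, coeff k (X * F) - x * coeff k F = r.coeff k := by
      intro k
      rw [← Polynomial.coeff_coe, ← h, Polynomial.coe_sub, Polynomial.coe_X, Polynomial.coe_C,
        sub_mul, map_sub, coeff_C_mul]
    intro n
    induction n with
    | zero =>
      have := hc 0
      simp at this
      simp
      linarith
    | succ n ih =>
      have := hc (n + 1)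
      rw [coeff_succ_X_mul] at this
      rw [Finset.sum_range_succ, neg_add, ← ih, ← this]
      ring
  have hlim : Tendsto (fun n => coeff n F) atTop (𝓝 0) := by
    have h2 := hF.tendsto_atTop_zero.sqrt
    simp only [Real.sqrt_sq_eq_abs, Real.sqrt_zero] at h2
    exact (tendsto_zero_iff_abs_tendsto_zero _).2 h2
  have hev : ∀ᶠ n in atTop, |r.eval x| ≤ |coeff n F| := by
    filter_upwards [eventually_ge_atTop r.natDegree] with n hn
    rw [Polynomial.eval_eq_sum_range' (Nat.lt_succ_of_le hn), ← abs_neg, ← hrec, abs_mul, abs_pow]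
    exact mul_le_of_le_one_left (abs_nonneg _) (pow_le_one₀ (abs_nonneg _) hx)
  have h0 : |r.eval x| ≤ 0 := by
    refine ge_of_tendsto ?_ hev
    simpa using hlim.abs
  simpa using h0

namespace TransferMatrix
variable {m : ℕ}

/-- Eliminating `e₁` and clearing denominators leaves a polynomial system for `e₂` alone, used for
both directions of the stability criterion. -/
lemma IsLoopSolution.loopMatrix_mulVec {P Q : TransferMatrix m} {w₁ w₂ e₁ e₂ : Signal m}
    (h : IsLoopSolution P Q w₁ w₂ e₁ e₂) :
    (toSeries (loopMatrix P Q)).mulVec (genFun e₂) =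
      (((P.commonDen * Q.commonDen : ℝ[X]) : PowerSeries ℝ) • genFun w₂ +
        (toSeries (Q.commonDen • P.commonNum)).mulVec (genFun w₁)) := by
  rw [isLoopSolution_iff] at h
  have h1 : (1 - P.impulseMatrix * Q.impulseMatrix).mulVec (genFun e₂) =
      genFun w₂ + P.impulseMatrix.mulVec (genFun w₁) := by
    rw [Matrix.sub_mulVec, Matrix.one_mulVec, ← Matrix.mulVec_mulVec, sub_eq_iff_eq_add, add_assoc,
      ← Matrix.mulVec_add, ← h.1]
    exact h.2
  have h2 : toSeries (Q.commonDen • P.commonNum) =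
      ((P.commonDen * Q.commonDen : ℝ[X]) : PowerSeries ℝ) • P.impulseMatrix := by
    ext1 i j
    simp only [toSeries, Matrix.map_apply, Matrix.smul_apply, smul_eq_mul, map_mul,
      Polynomial.coeToPowerSeries.ringHom_apply, ← commonDen_mul_impulseMatrix, Polynomial.coe_mul]
    ring
  rw [toSeries_loopMatrix, Matrix.smul_mulVec, h1, h2, Matrix.smul_mulVec, smul_add]

lemma toSeries_det (A : Matrix (Fin m) (Fin m) ℝ[X]) :
    (toSeries A).det = (A.det : PowerSeries ℝ) := by
  rw [← Polynomial.coeToPowerSeries.ringHom_apply, RingHom.map_det]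
  rfl

lemma isUnit_det_one_sub {P Q : TransferMatrix m} (h : (loopMatrix P Q).det.coeff 0 ≠ 0) :
    IsUnit (1 - P.impulseMatrix * Q.impulseMatrix).det := by
  have h1 : IsUnit (toSeries (loopMatrix P Q)).det := by
    rw [toSeries_det, PowerSeries.isUnit_iff_constantCoeff, Polynomial.constantCoeff_coe]
    exact h.isUnit
  rw [toSeries_loopMatrix, Matrix.det_smul] at h1
  exact isUnit_of_mul_isUnit_right h1

/-- Well-posedness only concerns `x = 0`: a matrix of power series is invertible as soon as its
determinant has nonzero constant term. -/
lemma existsUnique_isLoopSolution {P Q : TransferMatrix m}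
    (h : (loopMatrix P Q).det.coeff 0 ≠ 0) (w₁ w₂ : Signal m) :
    ∃! e : Signal m × Signal m, IsLoopSolution P Q w₁ w₂ e.1 e.2 := by
  have hu := isUnit_det_one_sub h
  set A := 1 - P.impulseMatrix * Q.impulseMatrix with hA
  have hsol : ∀ f₁ f₂ : Fin m → PowerSeries ℝ,
      (f₁ = genFun w₁ + Q.impulseMatrix.mulVec f₂ ∧ f₂ = genFun w₂ + P.impulseMatrix.mulVec f₁) ↔
      (f₁ = genFun w₁ + Q.impulseMatrix.mulVec f₂ ∧
        A.mulVec f₂ = genFun w₂ + P.impulseMatrix.mulVec (genFun w₁)) := by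
    intro f₁ f₂
    refine and_congr_right fun h1 => ?_
    rw [h1, hA, Matrix.sub_mulVec, Matrix.one_mulVec, ← Matrix.mulVec_mulVec, sub_eq_iff_eq_add,
      add_assoc, ← Matrix.mulVec_add]
  obtain ⟨e₂, he₂⟩ := genFun_surjective
    (A⁻¹.mulVec (genFun w₂ + P.impulseMatrix.mulVec (genFun w₁)))
  obtain ⟨e₁, he₁⟩ := genFun_surjective (genFun w₁ + Q.impulseMatrix.mulVec (genFun e₂))
  refine ⟨(e₁, e₂), ?_, ?_⟩
  · simp only [isLoopSolution_iff]
    rw [hsol]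
    refine ⟨he₁, ?_⟩
    rw [he₂, Matrix.mulVec_mulVec, Matrix.mul_nonsing_inv _ hu, Matrix.one_mulVec]
  · rintro ⟨f₁, f₂⟩ hf
    simp only [isLoopSolution_iff] at hf
    rw [hsol] at hf
    have h2 : f₂ = e₂ := by
      apply genFun_injective
      rw [he₂, ← hf.2, Matrix.mulVec_mulVec, Matrix.nonsing_inv_mul _ hu, Matrix.one_mulVec]
    have h1 : f₁ = e₁ := by
      apply genFun_injective
      rw [he₁, hf.1, h2]
    rw [h1, h2]

lemma _root_.Summable.sq_add {f g : ℕ → ℝ} (hf : Summable fun k => f k ^ 2)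
    (hg : Summable fun k => g k ^ 2) : Summable fun k => (f k + g k) ^ 2 := by
  refine Summable.of_nonneg_of_le (fun _ => sq_nonneg _) (fun k => ?_)
    ((hf.mul_left 2).add (hg.mul_left 2))
  nlinarith [sq_nonneg (f k - g k)]

lemma _root_.Summable.sq_finset_sum {ι : Type*} {s : Finset ι} {f : ι → ℕ → ℝ}
    (hf : ∀ i ∈ s, Summable fun k => f i k ^ 2) : Summable fun k => (∑ i ∈ s, f i k) ^ 2 := by
  classical
  induction s using Finset.induction_on with
  | empty => simp
  | insert a s ha ih =>
    simp only [Finset.sum_insert ha]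
    exact (hf a (Finset.mem_insert_self _ _)).sq_add
      (ih fun i hi => hf i (Finset.mem_insert_of_mem hi))

lemma summable_sq_mulVec {A : Matrix (Fin m) (Fin m) (PowerSeries ℝ)}
    (hA : ∀ i j, (A i j).AbsSummable) {f : Fin m → PowerSeries ℝ}
    (hf : ∀ i, Summable fun k => PowerSeries.coeff k (f i) ^ 2) (i : Fin m) :
    Summable fun k => PowerSeries.coeff k (A.mulVec f i) ^ 2 := by
  simp only [Matrix.mulVec, dotProduct, map_sum]
  exact Summable.sq_finset_sum fun j _ => (hA i j).summable_sq_coeff_mul (hf j)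

lemma FiniteEnergy.sub {u v : Signal m} (hu : FiniteEnergy u) (hv : FiniteEnergy v) :
    FiniteEnergy (u - v) := by
  refine Summable.of_nonneg_of_le (fun _ => Finset.sum_nonneg fun _ _ => sq_nonneg _) (fun k => ?_)
    ((Summable.mul_left 2 hu).add (Summable.mul_left 2 hv))
  rw [Finset.mul_sum, Finset.mul_sum, ← Finset.sum_add_distrib]
  refine Finset.sum_le_sum fun i _ => ?_
  simp only [Pi.sub_apply]
  nlinarith [sq_nonneg (u k i + v k i)]

/-- Cramer's rule expresses `e₂` through `w₁` and `w₂` by absolutely summable series. The other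
signals follow from `Q e₂`, `e₁ = w₁ + Q e₂` and `P e₁ = e₂ - w₂`. No summability of the impulse
response of `P` is needed, and `P` may have poles on the unit circle. -/
lemma internallyStable_of_absSummable {P Q : TransferMatrix m}
    (h0 : (loopMatrix P Q).det.coeff 0 ≠ 0)
    (hQ : ∀ i j, (Q.impulseMatrix i j).AbsSummable)
    (h1 : ∀ i j, (((((loopMatrix P Q).adjugate * (Q.commonDen • P.commonNum)) i j : ℝ[X]) :
      PowerSeries ℝ) * ((loopMatrix P Q).det : PowerSeries ℝ)⁻¹).AbsSummable)
    (h2 : ∀ i j, (((((P.commonDen * Q.commonDen) • (loopMatrix P Q).adjugate) i j : ℝ[X]) :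
      PowerSeries ℝ) * ((loopMatrix P Q).det : PowerSeries ℝ)⁻¹).AbsSummable) :
    InternallyStable P Q := by
  refine ⟨existsUnique_isLoopSolution h0, fun w₁ w₂ e₁ e₂ hw₁ hw₂ hsol => ?_⟩
  have hM := hsol.loopMatrix_mulVec
  set M := loopMatrix P Q with hMdef
  have hinv : (M.det : PowerSeries ℝ)⁻¹ * (M.det : PowerSeries ℝ) = 1 :=
    PowerSeries.inv_mul_cancel _ (by rwa [Polynomial.constantCoeff_coe])
  have hadj : toSeries M.adjugate = (toSeries M).adjugate := by
    exact RingHom.map_adjugate (Polynomial.coeToPowerSeries.ringHom (R := ℝ)) M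
  have he₂ : genFun e₂ =
      ((M.det : PowerSeries ℝ)⁻¹ • toSeries ((P.commonDen * Q.commonDen) • M.adjugate)).mulVec
        (genFun w₂) +
      ((M.det : PowerSeries ℝ)⁻¹ • toSeries (M.adjugate * (Q.commonDen • P.commonNum))).mulVec
        (genFun w₁) := by
    have hs : toSeries ((P.commonDen * Q.commonDen) • M.adjugate) =
        ((P.commonDen * Q.commonDen : ℝ[X]) : PowerSeries ℝ) • (toSeries M).adjugate := by
      rw [← hadj]
      ext1 i j
      simp [toSeries]
    have hm : toSeries (M.adjugate * (Q.commonDen • P.commonNum)) =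
        (toSeries M).adjugate * toSeries (Q.commonDen • P.commonNum) := by
      rw [← hadj]
      exact Matrix.map_mul
    have h := congrArg (fun v => (M.det : PowerSeries ℝ)⁻¹ • (toSeries M).adjugate.mulVec v) hM
    simp only [Matrix.mulVec_mulVec, Matrix.adjugate_mul, toSeries_det, Matrix.smul_mulVec,
      Matrix.one_mulVec, smul_smul, hinv, one_smul, Matrix.mulVec_add, Matrix.mulVec_smul,
      smul_add] at h
    rw [h, hs, hm]
    simp only [Matrix.smul_mulVec, smul_smul]
  have hE₂ : FiniteEnergy e₂ := by
    rw [finiteEnergy_iff] at hw₁ hw₂ ⊢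
    intro i
    rw [he₂]
    simp only [Pi.add_apply, map_add]
    refine Summable.sq_add (summable_sq_mulVec (fun i j => ?_) hw₂ i)
      (summable_sq_mulVec (fun i j => ?_) hw₁ i)
    · rw [Matrix.smul_apply, smul_eq_mul, mul_comm]
      exact h2 i j
    · rw [Matrix.smul_apply, smul_eq_mul, mul_comm]
      exact h1 i j
  have hQe₂ : FiniteEnergy (Q.output e₂) := by
    rw [finiteEnergy_iff] at hE₂ ⊢
    intro i
    rw [genFun_output]
    exact summable_sq_mulVec hQ hE₂ i
  have hE₁ : FiniteEnergy e₁ := by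
    rw [finiteEnergy_iff] at hw₁ hQe₂ ⊢
    intro i
    rw [hsol.1, genFun_add]
    simp only [Pi.add_apply, map_add]
    exact (hw₁ i).sq_add (hQe₂ i)
  refine ⟨hE₁, hE₂, ?_, hQe₂⟩
  have : P.output e₁ = e₂ - w₂ := by rw [eq_sub_iff_add_eq']; exact hsol.2.symm
  rw [this]
  exact hE₂.sub hw₂

/-- If the loop matrix `M` is singular at `x`, a left null vector `y` of `M(x)` makes the row `y M`
divisible by `X - x`. An impulse in a coordinate with `y j ≠ 0` then yields a square summable `F`
for which `(X - x) F` is `y j` times the common denominators, and this polynomial would have to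
vanish at `x`. -/
lemma InternallyStable.eval_det_loopMatrix_ne_zero {P Q : TransferMatrix m}
    (h : InternallyStable P Q) {x : ℝ} (hx : |x| ≤ 1)
    (hd : (P.commonDen * Q.commonDen).eval x ≠ 0) : (loopMatrix P Q).det.eval x ≠ 0 := by
  intro hdet
  set M := loopMatrix P Q with hM
  have hdet' : (M.map (Polynomial.eval x)).det = 0 := by
    rw [← hdet, ← Polynomial.coe_evalRingHom, RingHom.map_det]
    rfl
  obtain ⟨y, hy0, hy⟩ := Matrix.exists_vecMul_eq_zero_iff.2 hdet'
  obtain ⟨j, hj⟩ := Function.ne_iff.1 hy0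
  obtain ⟨w₂, hw₂⟩ := genFun_surjective (m := m) (Pi.single j 1)
  have hw₂E : FiniteEnergy w₂ := by
    rw [finiteEnergy_iff, hw₂]
    intro i
    refine summable_of_ne_finset_zero (s := {0}) fun k hk => ?_
    have hk0 : k ≠ 0 := by simpa using hk
    rcases eq_or_ne i j with rfl | hij
    · simp [PowerSeries.coeff_one, hk0]
    · simp [Pi.single_eq_of_ne hij]
  have h0E : FiniteEnergy (0 : Signal m) := by
    simp [FiniteEnergy]
  obtain ⟨⟨e₁, e₂⟩, hsol, -⟩ := h.1 0 w₂
  have hE := (h.2 0 w₂ e₁ e₂ h0E hw₂E hsol).2.1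
  rw [finiteEnergy_iff] at hE
  have hMe := hsol.loopMatrix_mulVec
  have hg0 : genFun (0 : Signal m) = 0 := by ext i k; simp [genFun]
  rw [hw₂, hg0, Matrix.mulVec_zero, add_zero] at hMe
  have hq : ∀ l, ∃ q : ℝ[X], ∑ i, Polynomial.C (y i) * M i l =
      (Polynomial.X - Polynomial.C x) * q := by
    intro l
    refine Polynomial.dvd_iff_isRoot.2 ?_
    have := congrFun hy l
    simpa [Matrix.vecMul, dotProduct, Polynomial.eval_finsetSum] using this
  choose q hq using hq
  have hF : Summable fun k => PowerSeries.coeff k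
      (∑ l, (q l : PowerSeries ℝ) * genFun e₂ l) ^ 2 := by
    simp only [map_sum]
    exact Summable.sq_finset_sum fun l _ =>
      (PowerSeries.AbsSummable.coe (q l)).summable_sq_coeff_mul (hE l)
  have hmul : ((Polynomial.X - Polynomial.C x : ℝ[X]) : PowerSeries ℝ) *
      (∑ l, (q l : PowerSeries ℝ) * genFun e₂ l) =
      ((Polynomial.C (y j) * (P.commonDen * Q.commonDen) : ℝ[X]) : PowerSeries ℝ) := by
    calc _ = ∑ l, ((∑ i, Polynomial.C (y i) * M i l : ℝ[X]) : PowerSeries ℝ) * genFun e₂ l := by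
          rw [Finset.mul_sum]
          refine Finset.sum_congr rfl fun l _ => ?_
          rw [hq, Polynomial.coe_mul, mul_assoc]
      _ = ∑ i, (Polynomial.C (y i) : PowerSeries ℝ) * (toSeries M).mulVec (genFun e₂) i := by
          simp only [Matrix.mulVec, dotProduct, Finset.mul_sum,
            ← Polynomial.coeToPowerSeries.ringHom_apply, map_sum, map_mul, Finset.sum_mul]
          rw [Finset.sum_comm]
          refine Finset.sum_congr rfl fun i _ => Finset.sum_congr rfl fun l _ => ?_
          rw [mul_assoc]
          rfl
      _ = _ := by
          rw [hMe, Finset.sum_eq_single j]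
          · simp
          · intro i _ hij
            simp [Pi.single_eq_of_ne hij]
          · simp
  have := PowerSeries.eval_eq_zero_of_X_sub_C_mul hx hF hmul
  rw [Polynomial.eval_mul, Polynomial.eval_C] at this
  exact mul_ne_zero hj hd this

end TransferMatrix

/-! ### Quadratic forms and positive definiteness -/

namespace Matrix
variable {m : ℕ}

/-- The quadratic form `v^* A v`. -/
noncomputable def quadForm (A : Matrix (Fin m) (Fin m) ℂ) (v : Fin m → ℂ) : ℂ := star v ⬝ᵥ A.mulVec v

lemma IsHermitian.star_dotProduct_mulVec {A : Matrix (Fin m) (Fin m) ℂ} (hA : A.IsHermitian)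
    (u v : Fin m → ℂ) : star u ⬝ᵥ A.mulVec v = star (A.mulVec u) ⬝ᵥ v := by
  rw [star_mulVec, hA.eq, dotProduct_mulVec]

lemma star_dotProduct_comm (u v : Fin m → ℂ) :
    star u ⬝ᵥ v = (starRingEnd ℂ) (star v ⬝ᵥ u) := by
  rw [starRingEnd_apply, star_dotProduct]

lemma re_star_dotProduct_comm (u v : Fin m → ℂ) : (star u ⬝ᵥ v).re = (star v ⬝ᵥ u).re := by
  rw [star_dotProduct_comm, Complex.conj_re]

lemma IsHermitian.quadForm_im {A : Matrix (Fin m) (Fin m) ℂ} (hA : A.IsHermitian)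
    (v : Fin m → ℂ) : (A.quadForm v).im = 0 := by
  rw [← Complex.conj_eq_iff_im, quadForm, ← star_dotProduct_comm, hA.star_dotProduct_mulVec]

lemma IsHermitian.posDef_of_re {A : Matrix (Fin m) (Fin m) ℂ} (hA : A.IsHermitian)
    (h : ∀ v, v ≠ 0 → 0 < (A.quadForm v).re) : A.PosDef :=
  .of_dotProduct_mulVec_pos hA fun v hv => Complex.lt_def.2 ⟨h v hv, (hA.quadForm_im v).symm⟩

lemma IsHermitian.posSemidef_of_re {A : Matrix (Fin m) (Fin m) ℂ} (hA : A.IsHermitian)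
    (h : ∀ v, 0 ≤ (A.quadForm v).re) : A.PosSemidef :=
  .of_dotProduct_mulVec_nonneg hA fun v => Complex.le_def.2 ⟨h v, (hA.quadForm_im v).symm⟩

lemma PosDef.re_quadForm_pos {A : Matrix (Fin m) (Fin m) ℂ} (hA : A.PosDef) {v : Fin m → ℂ}
    (hv : v ≠ 0) : 0 < (A.quadForm v).re :=
  (Complex.lt_def.1 (hA.dotProduct_mulVec_pos hv)).1

lemma PosSemidef.re_quadForm_nonneg {A : Matrix (Fin m) (Fin m) ℂ} (hA : A.PosSemidef)
    (v : Fin m → ℂ) : 0 ≤ (A.quadForm v).re :=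
  (Complex.le_def.1 (hA.dotProduct_mulVec_nonneg v)).1

lemma quadForm_smul (A : Matrix (Fin m) (Fin m) ℂ) (c : ℂ) (v : Fin m → ℂ) :
    A.quadForm (c • v) = (‖c‖ ^ 2 : ℝ) * A.quadForm v := by
  rw [quadForm, quadForm, mulVec_smul, star_smul, smul_dotProduct, dotProduct_smul, smul_smul,
    smul_eq_mul]
  congr 1
  rw [← Complex.normSq_eq_norm_sq, Complex.normSq_eq_conj_mul_self]
  rfl

lemma quadForm_eq_sum (A : Matrix (Fin m) (Fin m) ℂ) (v : Fin m → ℂ) :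
    A.quadForm v = ∑ i, star (v i) * ∑ j, A i j * v j := rfl

open Filter Topology Set in
/-- Along a continuous path of nonsingular Hermitian matrices, positive definiteness persists. -/
lemma PosDef.of_path {a b : ℝ} (hab : a ≤ b) {f : ℝ → Matrix (Fin m) (Fin m) ℂ}
    (hf : ContinuousOn f (Icc a b)) (hH : ∀ t ∈ Icc a b, (f t).IsHermitian)
    (hdet : ∀ t ∈ Icc a b, (f t).det ≠ 0) (ha : (f a).PosDef) : (f b).PosDef := by
  by_contra hb
  have hentry : ∀ i j, ContinuousOn (fun t => f t i j) (Icc a b) := fun i j =>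
    (continuous_apply_apply i j).comp_continuousOn hf
  have hcont : ContinuousOn (fun p : ℝ × (Fin m → ℂ) => ((f p.1).quadForm p.2).re)
      (Icc a b ×ˢ univ) := by
    refine Complex.continuous_re.comp_continuousOn ?_
    simp only [quadForm_eq_sum]
    refine continuousOn_finsetSum _ fun i _ => ContinuousOn.mul (by fun_prop) ?_
    refine continuousOn_finsetSum _ fun j _ => ContinuousOn.mul ?_ (by fun_prop)
    exact (hentry i j).comp continuousOn_fst fun p hp => hp.1
  have hcomp : IsCompact (Icc a b ×ˢ Metric.sphere (0 : Fin m → ℂ) 1) :=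
    isCompact_Icc.prod (isCompact_sphere _ _)
  set K := (Icc a b ×ˢ Metric.sphere (0 : Fin m → ℂ) 1) ∩
    (fun p : ℝ × (Fin m → ℂ) => ((f p.1).quadForm p.2).re) ⁻¹' Iic 0 with hK
  -- `K` collects the times and unit vectors at which positivity fails. Compactness provides a first
  -- such time `t₀`; by continuity `f t₀` is still positive semidefinite, and a vector on which its
  -- form vanishes lies in its kernel.
  have hKc : IsCompact K := hcomp.of_isClosed_subset
    ((hcont.mono (prod_mono_right (subset_univ _))).preimage_isClosed_of_isClosed hcomp.isClosed
      isClosed_Iic) inter_subset_left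
  have hmem : ∀ t ∈ Icc a b, ∀ v : Fin m → ℂ, v ≠ 0 → ((f t).quadForm v).re ≤ 0 →
      (t, ((‖v‖⁻¹ : ℝ) : ℂ) • v) ∈ K := by
    intro t ht v hv hle
    have hn : 0 < ‖v‖ := norm_pos_iff.2 hv
    refine ⟨⟨ht, ?_⟩, ?_⟩
    · simp only [mem_sphere_zero_iff_norm, norm_smul, Complex.norm_real, norm_inv, norm_norm]
      exact inv_mul_cancel₀ hn.ne'
    · simp only [mem_preimage, mem_Iic, quadForm_smul, Complex.re_ofReal_mul]
      exact mul_nonpos_of_nonneg_of_nonpos (sq_nonneg _) hle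
  have hKne : K.Nonempty := by
    by_contra hempty
    refine hb ((hH b (right_mem_Icc.2 hab)).posDef_of_re fun v hv => ?_)
    by_contra hle
    exact hempty ⟨_, hmem b (right_mem_Icc.2 hab) v hv (not_lt.1 hle)⟩
  obtain ⟨⟨t₀, v₀⟩, ⟨⟨ht₀, hv₀⟩, hle₀⟩, hmin⟩ :=
    hKc.exists_isMinOn hKne continuous_fst.continuousOn
  simp only [mem_preimage, mem_Iic] at hle₀ ht₀ hv₀
  have hv₀0 : v₀ ≠ 0 := by
    rintro rfl
    simp at hv₀
  have hat : a < t₀ := by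
    rcases ht₀.1.eq_or_lt with h | h
    · rw [← h] at hle₀
      exact absurd (ha.re_quadForm_pos hv₀0) (not_lt.2 hle₀)
    · exact h
  have hpos : ∀ t ∈ Ico a t₀, ∀ v : Fin m → ℂ, 0 ≤ ((f t).quadForm v).re := by
    intro t ht v
    rcases eq_or_ne v 0 with rfl | hv
    · simp [quadForm]
    · by_contra hlt
      have := hmin (hmem t ⟨ht.1, ht.2.le.trans ht₀.2⟩ v hv (not_le.1 hlt).le)
      exact absurd ht.2 (not_lt.2 this)
  have hpsd : (f t₀).PosSemidef := by
    refine (hH t₀ ht₀).posSemidef_of_re fun v => ?_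
    have hc : ContinuousOn (fun t => ((f t).quadForm v).re) (Icc a b) :=
      hcont.comp (f := fun t => (t, v)) (by fun_prop) fun t ht => ⟨ht, mem_univ _⟩
    have hlim : Tendsto (fun t => ((f t).quadForm v).re) (𝓝[Ico a t₀] t₀)
        (𝓝 ((f t₀).quadForm v).re) :=
      (hc t₀ ht₀).mono_left (nhdsWithin_mono _ fun t ht => ⟨ht.1, ht.2.le.trans ht₀.2⟩)
    have : (𝓝[Ico a t₀] t₀).NeBot := by
      rw [nhdsWithin_Ico_eq_nhdsLT hat]
      infer_instance
    refine ge_of_tendsto hlim ?_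
    filter_upwards [self_mem_nhdsWithin] with t ht using hpos t ht v
  refine hdet t₀ ht₀ (exists_mulVec_eq_zero_iff.1 ⟨v₀, hv₀0, ?_⟩)
  rw [← hpsd.dotProduct_mulVec_zero_iff]
  exact Complex.ext (le_antisymm hle₀ (hpsd.re_quadForm_nonneg v₀)) (hpsd.1.quadForm_im v₀)

lemma mem_spectrum_iff_exists_mulVec {A : Matrix (Fin m) (Fin m) ℂ} {μ : ℂ} :
    μ ∈ spectrum ℂ A ↔ ∃ v, v ≠ 0 ∧ A.mulVec v = μ • v := by
  rw [spectrum.mem_iff, isUnit_iff_isUnit_det, isUnit_iff_ne_zero, not_not,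
    ← exists_mulVec_eq_zero_iff]
  refine exists_congr fun v => and_congr_right fun _ => ?_
  rw [Algebra.algebraMap_eq_smul_one, sub_mulVec, smul_mulVec, one_mulVec, sub_eq_zero, eq_comm]

variable {P Q : Matrix (Fin m) (Fin m) ℂ}

lemma IsHermitian.quadForm_mul_mul (hQ : Q.IsHermitian) (v : Fin m → ℂ) :
    (Q * P * Q).quadForm v = P.quadForm (Q.mulVec v) := by
  rw [quadForm, quadForm, ← mulVec_mulVec, ← mulVec_mulVec, hQ.star_dotProduct_mulVec]

lemma quadForm_sub (v : Fin m → ℂ) : (P - Q).quadForm v = P.quadForm v - Q.quadForm v := by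
  rw [quadForm, sub_mulVec, dotProduct_sub]
  rfl

/-- Pairing the eigenvalue equation with `Q v` replaces the non-Hermitian product `P Q` by the forms
of `P` and `Q` separately. -/
lemma IsHermitian.quadForm_mulVec_eq (hQ : Q.IsHermitian) {v : Fin m → ℂ} {μ : ℂ}
    (hv : (P * Q).mulVec v = μ • v) : P.quadForm (Q.mulVec v) = μ * Q.quadForm v := by
  rw [quadForm, mulVec_mulVec, hv, ← hQ.star_dotProduct_mulVec, mulVec_smul, dotProduct_smul,
    smul_eq_mul]
  rfl

lemma PosDef.eigenvalue_mul_im (hQ : Q.PosDef) (hP : P.IsHermitian) {v : Fin m → ℂ} {μ : ℂ}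
    (hv0 : v ≠ 0) (hv : (P * Q).mulVec v = μ • v) : μ.im = 0 := by
  have h := congrArg Complex.im (hQ.1.quadForm_mulVec_eq hv)
  rw [hP.quadForm_im, Complex.mul_im, hQ.1.quadForm_im, mul_zero, zero_add] at h
  exact (mul_eq_zero.1 h.symm).resolve_right (hQ.re_quadForm_pos hv0).ne'

/-- On the eigenvector the form of `Q - Q P Q` equals `(1 - μ)` times that of `Q`. -/
lemma PosDef.eigenvalue_mul_lt_one (hQ : Q.PosDef) (hH : (Q - Q * P * Q).PosDef)
    {v : Fin m → ℂ} {μ : ℝ} (hv0 : v ≠ 0) (hv : (P * Q).mulVec v = (μ : ℂ) • v) : μ < 1 := by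
  have h := hH.re_quadForm_pos hv0
  rw [quadForm_sub, hQ.1.quadForm_mul_mul, hQ.1.quadForm_mulVec_eq hv, Complex.sub_re,
    Complex.re_ofReal_mul] at h
  nlinarith [hQ.re_quadForm_pos hv0]

lemma IsHermitian.sub_smul_mul_mul (hQ : Q.IsHermitian) (hP : P.IsHermitian) (s : ℝ) :
    (Q - (s : ℂ) • (Q * P * Q)).IsHermitian := by
  rw [IsHermitian, conjTranspose_sub, conjTranspose_smul, conjTranspose_mul, conjTranspose_mul,
    hQ.eq, hP.eq, Complex.star_def, Complex.conj_ofReal, Matrix.mul_assoc]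

lemma det_sub_smul_mul_mul (s : ℂ) :
    (Q - s • (Q * P * Q)).det = Q.det * (1 - s • (P * Q)).det := by
  rw [← det_mul, Matrix.mul_sub, Matrix.mul_one, Matrix.mul_smul, ← Matrix.mul_assoc]

open Set in
-- The path `Q - s Q P Q = Q (1 - s P Q)` joins `Q` to `Q - Q P Q` through nonsingular Hermitian
-- matrices.
lemma PosDef.sub_mul_mul_of_det_ne_zero (hQ : Q.PosDef) (hP : P.IsHermitian)
    (h : ∀ s ∈ Icc (0 : ℝ) 1, (1 - (s : ℂ) • (P * Q)).det ≠ 0) : (Q - Q * P * Q).PosDef := by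
  have := PosDef.of_path (f := fun s : ℝ => Q - (s : ℂ) • (Q * P * Q)) zero_le_one
    (by fun_prop) (fun s _ => hQ.1.sub_smul_mul_mul hP s)
    (fun s hs => by
      rw [det_sub_smul_mul_mul]
      exact mul_ne_zero (ne_of_gt hQ.det_pos) (h s hs))
    (by simpa using hQ)
  simpa using this

/-- A singular point `s` of the path would make `1/s ≥ 1` an eigenvalue of `P Q`. -/
lemma PosDef.sub_mul_mul_of_eigenvalue_lt_one (hQ : Q.PosDef) (hP : P.IsHermitian)
    (h : ∀ μ : ℝ, (μ : ℂ) ∈ spectrum ℂ (P * Q) → μ < 1) : (Q - Q * P * Q).PosDef := by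
  refine hQ.sub_mul_mul_of_det_ne_zero hP fun s hs hdet => ?_
  obtain ⟨v, hv0, hv⟩ := exists_mulVec_eq_zero_iff.2 hdet
  rw [sub_mulVec, one_mulVec, smul_mulVec, sub_eq_zero] at hv
  have hs0 : s ≠ 0 := by
    rintro rfl
    simp [hv0] at hv
  have hlt : s⁻¹ < 1 := by
    refine h _ (mem_spectrum_iff_exists_mulVec.2 ⟨v, hv0, ?_⟩)
    nth_rewrite 2 [hv]
    rw [smul_smul, Complex.ofReal_inv, inv_mul_cancel₀ (by exact_mod_cast hs0), one_smul]
  exact absurd hlt (not_lt.2 ((one_le_inv₀ (lt_of_le_of_ne hs.1 hs0.symm)).2 hs.2))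

/-- If `Q₁ - Q₁ P₁ Q₁` is positive definite, `P ≤ P₁` and `0 ≤ Q ≤ Q₁`, then `I - P Q` is
nonsingular. -/
lemma det_one_sub_mul_ne_zero_of_le {P₁ Q₁ : Matrix (Fin m) (Fin m) ℂ} (hQ₁ : Q₁.PosDef)
    (hH : (Q₁ - Q₁ * P₁ * Q₁).PosDef) (hQ : Q.PosSemidef)
    (hPle : ∀ v, (P.quadForm v).re ≤ (P₁.quadForm v).re)
    (hQle : ∀ v, (Q.quadForm v).re ≤ (Q₁.quadForm v).re) : (1 - P * Q).det ≠ 0 := by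
  intro hdet
  obtain ⟨v, hv0, hv⟩ := exists_mulVec_eq_zero_iff.2 hdet
  rw [sub_mulVec, one_mulVec, sub_eq_zero, ← mulVec_mulVec] at hv
  set u := Q.mulVec v with hu
  have hu0 : u ≠ 0 := by
    intro h
    rw [h, mulVec_zero] at hv
    exact hv0 hv
  -- In real parts: positivity of `Q₁ - Q₁ P₁ Q₁` at `y` reads `u^*P₁u < y^*u`, and `v = P u` gives
  -- `v^*u ≤ u^*P₁u`. Expanding `(v - y)^*Q(v - y) ≥ 0` gives `2 y^*u ≤ v^*u + y^*Qy ≤ v^*u + y^*u`,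
  -- a contradiction. The possibly singular `Q` is never inverted.
  set y := Q₁⁻¹.mulVec u with hy
  have hQy : Q₁.mulVec y = u := by
    rw [hy, mulVec_mulVec, mul_nonsing_inv _ (isUnit_iff_ne_zero.2 (ne_of_gt hQ₁.det_pos)),
      one_mulVec]
  have hy0 : y ≠ 0 := by
    intro h
    rw [h, mulVec_zero] at hQy
    exact hu0 hQy.symm
  have h1 := hH.re_quadForm_pos hy0
  rw [quadForm_sub, hQ₁.1.quadForm_mul_mul, hQy, Complex.sub_re,
    show Q₁.quadForm y = star y ⬝ᵥ u by rw [quadForm, hQy]] at h1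
  have h2 : (star v ⬝ᵥ u).re ≤ (P₁.quadForm u).re := by
    refine le_trans (le_of_eq ?_) (hPle u)
    rw [quadForm, ← hv, re_star_dotProduct_comm]
  have h3 := hQ.re_quadForm_nonneg (v - y)
  have h4 : Q.quadForm (v - y) = star v ⬝ᵥ u - star u ⬝ᵥ y - star y ⬝ᵥ u + Q.quadForm y := by
    rw [hu, ← hQ.1.star_dotProduct_mulVec, quadForm, quadForm, mulVec_sub, star_sub,
      sub_dotProduct, dotProduct_sub, dotProduct_sub]
    ring
  rw [h4, Complex.add_re, Complex.sub_re, Complex.sub_re, re_star_dotProduct_comm u y] at h3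
  have h5 := hQle y
  rw [show Q₁.quadForm y = star y ⬝ᵥ u by rw [quadForm, hQy]] at h5
  linarith

end Matrix

/-! ### Holomorphic functions on the lower half disc -/

open Set Filter Topology

namespace Matrix
variable {m : ℕ}

lemma re_quadForm_skew (A : Matrix (Fin m) (Fin m) ℂ) (v : Fin m → ℂ) :
    ((Complex.I • (A - A.conjTranspose)).quadForm v).re = -2 * (A.quadForm v).im := by
  have h : star v ⬝ᵥ A.conjTranspose.mulVec v = (starRingEnd ℂ) (A.quadForm v) := by
    rw [quadForm, ← star_dotProduct_comm, star_mulVec, ← dotProduct_mulVec]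
  rw [quadForm, smul_mulVec, dotProduct_smul, sub_mulVec, dotProduct_sub, h, smul_eq_mul,
    Complex.I_mul_re, Complex.sub_im, Complex.conj_im]
  simp only [quadForm]
  ring

end Matrix

namespace Complex

lemma frontier_lower_half_disc {x : ℂ}
    (hx : x ∈ frontier (Metric.ball (0 : ℂ) 1 ∩ {z | z.im < 0})) :
    ‖x‖ ≤ 1 ∧ x.im ≤ 0 ∧ (x.im = 0 ∨ ‖x‖ = 1) := by
  have hopen : IsOpen (Metric.ball (0 : ℂ) 1 ∩ {z | z.im < 0}) :=
    Metric.isOpen_ball.inter (isOpen_lt continuous_im continuous_const)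
  rw [hopen.frontier_eq] at hx
  have hcl : x ∈ Metric.closedBall (0 : ℂ) 1 ∩ {z | z.im ≤ 0} :=
    closure_minimal (inter_subset_inter Metric.ball_subset_closedBall fun z hz => le_of_lt hz)
      (Metric.isClosed_closedBall.inter (isClosed_le continuous_im continuous_const)) hx.1
  have h1 : ‖x‖ ≤ 1 := by simpa using hcl.1
  refine ⟨h1, hcl.2, ?_⟩
  by_contra! h
  refine hx.2 ⟨?_, lt_of_le_of_ne hcl.2 h.1⟩
  simpa using lt_of_le_of_ne h1 h.2

/-- Strict minimum principle for the imaginary part on the lower half disc. -/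
lemma im_neg_of_lower_half_disc {h : ℂ → ℂ} (hd : ∀ x : ℂ, ‖x‖ ≤ 1 → DifferentiableAt ℂ h x)
    (hreal : ∀ x : ℂ, ‖x‖ ≤ 1 → x.im = 0 → (h x).im = 0)
    (hcirc : ∀ x : ℂ, ‖x‖ = 1 → x.im < 0 → (h x).im < 0) {x : ℂ} (hx : ‖x‖ ≤ 1)
    (hxim : x.im < 0) : (h x).im < 0 := by
  rcases hx.eq_or_lt with hx1 | hx1
  · exact hcirc x hx1 hxim
  set U : Set ℂ := Metric.ball (0 : ℂ) 1 ∩ {z | z.im < 0} with hU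
  have hopen : IsOpen U := Metric.isOpen_ball.inter (isOpen_lt continuous_im continuous_const)
  have hconv : Convex ℝ U := (convex_ball 0 1).inter (convex_halfSpace_im_lt 0)
  have hcl : closure U ⊆ Metric.closedBall (0 : ℂ) 1 :=
    (closure_mono inter_subset_left).trans Metric.closure_ball_subset_closedBall
  -- The modulus of `f` is `exp (Im h)`, which turns a bound on `Im h` into the maximum modulus
  -- principle.
  set f : ℂ → ℂ := fun z => exp (-I * h z) with hf
  have hnorm : ∀ z, ‖f z‖ = Real.exp (h z).im := by
    intro z
    rw [hf, norm_exp]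
    simp
  have hdf : DiffContOnCl ℂ f U := by
    refine DifferentiableOn.diffContOnCl fun z hz => ?_
    have hz1 : ‖z‖ ≤ 1 := by simpa using hcl hz
    exact (((hd z hz1).const_mul (-I)).cexp).differentiableWithinAt
  have hle : ∀ z ∈ frontier U, ‖f z‖ ≤ 1 := by
    intro z hz
    obtain ⟨h1, h2, h3⟩ := frontier_lower_half_disc hz
    rw [hnorm, Real.exp_le_one_iff]
    rcases h2.eq_or_lt with h0 | h0
    · exact (hreal z h1 h0).le
    · exact (hcirc z (h3.resolve_left h0.ne) h0).le
  have hbdd : Bornology.IsBounded U := Metric.isBounded_ball.subset inter_subset_left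
  have hxU : x ∈ U := ⟨by simpa using hx1, hxim⟩
  have hall : ∀ z ∈ U, ‖f z‖ ≤ 1 := fun z hz =>
    norm_le_of_forall_mem_frontier_norm_le hbdd hdf hle (subset_closure hz)
  have hx0 : (h x).im ≤ 0 := by
    have := hall x hxU
    rwa [hnorm, Real.exp_le_one_iff] at this
  refine lt_of_le_of_ne hx0 fun heq => ?_
  have hfx : ‖f x‖ = 1 := by rw [hnorm, heq, Real.exp_zero]
  have hmax : IsMaxOn (norm ∘ f) U x := fun z hz => by
    simpa [hfx] using hall z hz
  -- Equality at an interior point makes `|f|` constant up to the boundary, which fails at `-I`,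
  -- where the circle hypothesis is strict.
  have hconst := norm_eqOn_closure_of_isPreconnected_of_isMaxOn hconv.isPreconnected hopen hdf
    hxU hmax
  have hI : (-I : ℂ) ∈ closure U := by
    refine mem_closure_of_tendsto (f := fun t : ℝ => (t : ℂ) * (-I)) (b := 𝓝[<] (1 : ℝ)) ?_ ?_
    · have hc : Continuous fun t : ℝ => (t : ℂ) * (-I) := by fun_prop
      have := (hc.tendsto 1).mono_left (nhdsWithin_le_nhds (s := Iio 1))
      simpa using this
    · filter_upwards [self_mem_nhdsWithin, nhdsWithin_le_nhds (lt_mem_nhds one_half_lt_one)]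
        with t ht ht2
      have ht0 : 0 < t := by linarith
      refine ⟨?_, ?_⟩
      · simpa [abs_of_pos ht0] using ht
      · simpa using ht0
  have h1 := hconst hI
  simp only [Function.comp_apply, Function.const_apply, hfx] at h1
  rw [hnorm, Real.exp_eq_one_iff] at h1
  exact absurd h1 (hcirc (-I) (by simp) (by simp)).ne

/-- A function which is real on the real axis and maps the lower half disc to the closed lower
half plane is nondecreasing on the real axis. -/
lemma monotoneOn_re_of_im_nonpos {h : ℂ → ℂ} (hd : ∀ x ∈ Icc (-1 : ℝ) 1, DifferentiableAt ℂ h x)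
    (hreal : ∀ x ∈ Icc (-1 : ℝ) 1, (h x).im = 0)
    (hlow : ∀ x : ℂ, ‖x‖ < 1 → x.im < 0 → (h x).im ≤ 0) :
    MonotoneOn (fun t : ℝ => (h t).re) (Icc (-1) 1) := by
  have hderiv : ∀ x ∈ Icc (-1 : ℝ) 1,
      HasDerivAt (fun t : ℝ => (h t).re) (deriv h x).re x := fun x hx =>
    (hd x hx).hasDerivAt.real_of_complex
  refine monotoneOn_of_deriv_nonneg (convex_Icc _ _)
    (fun x hx => (hderiv x hx).continuousAt.continuousWithinAt)
    (fun x hx => (hderiv x (interior_subset hx)).differentiableAt.differentiableWithinAt)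
    fun x hx => ?_
  rw [(hderiv x (interior_subset hx)).deriv]
  rw [interior_Icc] at hx
  have hx' := Ioo_subset_Icc_self hx
  -- Cauchy–Riemann by a difference quotient: for real `t` the real part of this function is `-Im
  -- h(x - it)`. It vanishes at `t = 0`, is nonnegative for small `t > 0`, and has derivative `Re
  -- h'(x)` at `0`.
  have hg : HasDerivAt (fun t : ℂ => I * h (x - I * t)) (I * (deriv h x * -I)) ((0 : ℝ) : ℂ) := by
    refine HasDerivAt.const_mul I ?_
    have h1 : HasDerivAt (fun t : ℂ => (x : ℂ) - I * t) (-I) ((0 : ℝ) : ℂ) := by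
      simpa using ((hasDerivAt_id ((0 : ℝ) : ℂ)).const_mul I).const_sub (x : ℂ)
    refine HasDerivAt.comp (h₂ := h) ((0 : ℝ) : ℂ) ?_ h1
    simpa using (hd x hx').hasDerivAt
  have hg' := hg.real_of_complex
  have heq : (I * (deriv h x * -I)).re = (deriv h x).re := by simp
  rw [heq] at hg'
  have hslope := hg'.tendsto_slope_zero_right
  refine ge_of_tendsto hslope ?_
  have hsmall : ∀ᶠ t : ℝ in 𝓝[>] 0, ‖(x : ℂ) - I * t‖ < 1 := by
    have hc : Continuous fun t : ℝ => ‖(x : ℂ) - I * t‖ := by fun_prop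
    refine nhdsWithin_le_nhds (hc.continuousAt.eventually_lt continuousAt_const ?_)
    simpa using abs_lt.2 hx
  filter_upwards [hsmall, self_mem_nhdsWithin] with t ht htpos
  have htpos : 0 < t := htpos
  have h1 := hlow _ ht (by simpa using htpos)
  have h2 := hreal x hx'
  simp only [zero_add, smul_eq_mul, I_mul_re, ofReal_zero, mul_zero, sub_zero, h2, neg_zero]
  exact mul_nonneg (inv_pos.2 htpos).le (by linarith)

/-- The strict version of `monotoneOn_re_of_im_nonpos`. -/
lemma strictMonoOn_re_of_im_neg {h : ℂ → ℂ} (hd : ∀ x : ℂ, ‖x‖ ≤ 1 → DifferentiableAt ℂ h x)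
    (hreal : ∀ x ∈ Icc (-1 : ℝ) 1, (h x).im = 0)
    (hlow : ∀ x : ℂ, ‖x‖ < 1 → x.im < 0 → (h x).im < 0) :
    StrictMonoOn (fun t : ℝ => (h t).re) (Icc (-1) 1) := by
  have hmono := monotoneOn_re_of_im_nonpos
    (fun x hx => hd x (by simpa using abs_le.2 hx)) hreal fun x h1 h2 => (hlow x h1 h2).le
  intro s hs t ht hst
  refine lt_of_le_of_ne (hmono hs ht hst.le) fun heq => ?_
  simp only at heq
  have hc : ∀ r ∈ Icc s t, h r = h s := by
    intro r hr
    have hr' : r ∈ Icc (-1 : ℝ) 1 := ⟨hs.1.trans hr.1, hr.2.trans ht.2⟩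
    refine Complex.ext ?_ (by rw [hreal r hr', hreal s hs])
    refine le_antisymm ?_ (hmono hs hr' hr.1)
    rw [heq]
    exact hmono hr' ht hr.2
  have hmid : ((s + t) / 2) ∈ Ioo s t := ⟨by linarith, by linarith⟩
  -- Equal values at `s < t` make `h` constant on `[s, t]`, hence on the disc by the identity
  -- theorem; the point `-I / 2` contradicts this.
  have han : AnalyticOnNhd ℂ h (Metric.ball 0 1) := by
    refine DifferentiableOn.analyticOnNhd (fun z hz => ?_) Metric.isOpen_ball
    exact (hd z (by simpa using (mem_ball_zero_iff.1 hz).le)).differentiableWithinAt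
  have hfreq : ∃ᶠ z in 𝓝[≠] (((s + t) / 2 : ℝ) : ℂ), h z = h s := by
    have htend : Tendsto (fun r : ℝ => (r : ℂ)) (𝓝[≠] ((s + t) / 2))
        (𝓝[≠] (((s + t) / 2 : ℝ) : ℂ)) := by
      refine tendsto_nhdsWithin_iff.2
        ⟨(continuous_ofReal.tendsto _).mono_left nhdsWithin_le_nhds, ?_⟩
      filter_upwards [self_mem_nhdsWithin] with r hr
      simpa only [mem_compl_iff, mem_singleton_iff, ofReal_inj] using hr
    refine htend.frequently (Eventually.frequently ?_)
    filter_upwards [nhdsWithin_le_nhds (Icc_mem_nhds hmid.1 hmid.2)] with r hr using hc r hr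
  have heqOn := han.eqOn_of_preconnected_of_frequently_eq analyticOnNhd_const
    (convex_ball (0 : ℂ) 1).isPreconnected (z₀ := (((s + t) / 2 : ℝ) : ℂ)) (by
      rw [mem_ball_zero_iff, norm_real, Real.norm_eq_abs, abs_lt]
      exact ⟨by linarith [hs.1, hmid.1], by linarith [ht.2, hmid.2]⟩) hfreq
  have hhalf : ‖(-I / 2 : ℂ)‖ < 1 := by simp; norm_num
  have h1 := heqOn (mem_ball_zero_iff.2 hhalf)
  have h2 := hlow _ hhalf (by simp; norm_num)
  rw [h1, hreal s hs] at h2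
  exact lt_irrefl _ h2

end Complex

/-! ### Negative imaginary systems: sign and monotonicity of the quadratic forms -/

namespace TransferMatrix
variable {m : ℕ} {P Q G : TransferMatrix m}

lemma differentiableAt_quadForm {x : ℂ} (hx : G.RegularAt x) (v : Fin m → ℂ) :
    DifferentiableAt ℂ (fun y => (G.recipAt y).quadForm v) x := by
  simp only [Matrix.quadForm_eq_sum]
  refine DifferentiableAt.fun_sum fun i _ => DifferentiableAt.const_mul ?_ _
  exact DifferentiableAt.fun_sum fun j _ => (differentiableAt_recipAt hx i j).mul_const _

lemma im_inv_pos {x : ℂ} (hx : x.im < 0) : 0 < (x⁻¹).im := by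
  rw [Complex.inv_im]
  exact div_pos (neg_pos.2 hx) (Complex.normSq_pos.2 fun h => by simp [h] at hx)

lemma ne_zero_of_im_neg {x : ℂ} (hx : x.im < 0) : x ≠ 0 := by
  rintro rfl
  simp at hx

lemma IsDNI.regularAt (hP : P.IsDNI) {x : ℂ} (hx : ‖x‖ < 1) : P.RegularAt x := by
  rcases eq_or_ne x 0 with rfl | h0
  · exact P.regularAt_zero
  · refine regularAt_of_ne_zero h0 (hP.analytic _ ?_)
    rw [norm_inv]
    exact (one_lt_inv₀ (norm_pos_iff.2 h0)).2 hx

lemma IsDWSNI.regularAt (hQ : Q.IsDWSNI) {x : ℂ} (hx : ‖x‖ ≤ 1) : Q.RegularAt x := by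
  rcases eq_or_ne x 0 with rfl | h0
  · exact Q.regularAt_zero
  · refine regularAt_of_ne_zero h0 fun h => ?_
    have := hQ.poles _ h
    rw [norm_inv] at this
    exact absurd this (not_lt.2 ((one_le_inv₀ (norm_pos_iff.2 h0)).2 hx))

lemma IsDNI.regularAt_real (hP : P.IsDNI) (h1 : ¬ P.IsPole 1) (h2 : ¬ P.IsPole (-1)) {x : ℝ}
    (hx : x ∈ Icc (-1 : ℝ) 1) : P.RegularAt x := by
  rcases hx.1.eq_or_lt with rfl | hl
  · exact regularAt_of_ne_zero (by simp) (by simpa [inv_neg] using h2)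
  rcases hx.2.eq_or_lt with rfl | hr
  · exact regularAt_of_ne_zero (by simp) (by simpa using h1)
  · exact hP.regularAt (by simpa using abs_lt.2 ⟨hl, hr⟩)

lemma IsDNI.im_quadForm_nonpos (hP : P.IsDNI) (hprop : P.IsProper) {x : ℂ} (hx : ‖x‖ < 1)
    (him : x.im < 0) (v : Fin m → ℂ) : ((P.recipAt x).quadForm v).im ≤ 0 := by
  have h0 := ne_zero_of_im_neg him
  have h := (hP.upper x⁻¹ (by rw [norm_inv]; exact (one_lt_inv₀ (norm_pos_iff.2 h0)).2 hx)
    (im_inv_pos him)).re_quadForm_nonneg v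
  rw [skewPart, Matrix.re_quadForm_skew, ← recipAt_eq hprop h0] at h
  linarith

lemma IsDWSNI.im_quadForm_neg_circle (hQ : Q.IsDWSNI) (hprop : Q.IsProper) {x : ℂ} (hx : ‖x‖ = 1)
    (him : x.im < 0) {v : Fin m → ℂ} (hv : v ≠ 0) : ((Q.recipAt x).quadForm v).im < 0 := by
  have h0 := ne_zero_of_im_neg him
  have hpos := im_inv_pos him
  have hexp : Complex.exp ((Complex.arg x⁻¹ : ℂ) * Complex.I) = x⁻¹ := by
    have := Complex.norm_mul_exp_arg_mul_I x⁻¹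
    rwa [norm_inv, hx, inv_one, Complex.ofReal_one, one_mul] at this
  have hlt : Complex.arg x⁻¹ < Real.pi :=
    lt_of_le_of_ne (Complex.arg_le_pi _) fun h => hpos.ne' (Complex.arg_eq_pi_iff.1 h).2
  have hgt : 0 < Complex.arg x⁻¹ :=
    lt_of_le_of_ne (Complex.arg_nonneg_iff.2 hpos.le) fun h =>
      hpos.ne' (Complex.arg_eq_zero_iff.1 h.symm).2
  have h := (hQ.circle _ ⟨hgt, hlt⟩).re_quadForm_pos hv
  rw [hexp, skewPart, Matrix.re_quadForm_skew, ← recipAt_eq hprop h0] at h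
  linarith

lemma isHermitian_recipAt_of_isSymm (hG : G.IsSymm) {x : ℂ} (hx : x.im = 0) :
    (G.recipAt x).IsHermitian := by
  ext i j
  have hconj : (starRingEnd ℂ) x = x := Complex.conj_eq_iff_im.2 hx
  rw [Matrix.conjTranspose_apply, recipAt, recipAt, hG.apply, Complex.star_def, map_div₀,
    ← Polynomial.aeval_conj, ← Polynomial.aeval_conj, hconj]

/-- Being Hermitian is a closed condition. This reaches `x = 0` and `x = ±1`, about which
`IsDNI.real` says nothing. -/
lemma isHermitian_recipAt_of_Ioo {a b : ℝ} (hab : a ≠ b)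
    (hreg : ∀ x ∈ Icc a b, G.RegularAt (x : ℂ))
    (h : ∀ x ∈ Ioo a b, (G.recipAt (x : ℂ)).IsHermitian) {x : ℝ} (hx : x ∈ Icc a b) :
    (G.recipAt (x : ℂ)).IsHermitian := by
  have hne : (𝓝[Ioo a b] x).NeBot := by
    rw [← mem_closure_iff_nhdsWithin_neBot, closure_Ioo hab]
    exact hx
  have hc : ContinuousAt (fun t : ℝ => G.recipAt (t : ℂ)) x :=
    ContinuousAt.comp (f := fun t : ℝ => (t : ℂ)) (continuousAt_recipAt (hreg x hx))
      Complex.continuous_ofReal.continuousAt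
  have hlim : Tendsto (fun t : ℝ => G.recipAt (t : ℂ)) (𝓝[Ioo a b] x)
      (𝓝 (G.recipAt (x : ℂ))) := hc.mono_left nhdsWithin_le_nhds
  have hlim' : Tendsto (fun t : ℝ => (G.recipAt (t : ℂ)).conjTranspose) (𝓝[Ioo a b] x)
      (𝓝 (G.recipAt (x : ℂ)).conjTranspose) :=
    ((continuous_id.matrix_conjTranspose).tendsto _).comp hlim
  refine tendsto_nhds_unique_of_eventuallyEq hlim' hlim ?_
  filter_upwards [self_mem_nhdsWithin] with t ht using h t ht

lemma IsDNI.isHermitian_recipAt (hP : P.IsDNI) (hprop : P.IsProper) (h1 : ¬ P.IsPole 1)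
    (h2 : ¬ P.IsPole (-1)) {x : ℝ} (hx : x ∈ Icc (-1 : ℝ) 1) :
    (P.recipAt (x : ℂ)).IsHermitian := by
  have hne : ∀ t : ℝ, |t| < 1 → t ≠ 0 → (P.recipAt (t : ℂ)).IsHermitian := by
    intro t ht ht0
    have ht0' : (t : ℂ) ≠ 0 := by exact_mod_cast ht0
    have h := hP.real (t : ℂ)⁻¹ (by
      rw [norm_inv, Complex.norm_real, Real.norm_eq_abs]
      exact (one_lt_inv₀ (abs_pos.2 ht0)).2 ht) (by rw [← Complex.ofReal_inv, Complex.ofReal_im])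
    rw [skewPart, ← recipAt_eq hprop ht0', smul_eq_zero_iff_right Complex.I_ne_zero,
      sub_eq_zero] at h
    exact h.symm
  have hreg : ∀ t ∈ Icc (-1 : ℝ) 1, P.RegularAt (t : ℂ) := fun t ht => hP.regularAt_real h1 h2 ht
  rcases le_total x 0 with h | h
  · exact isHermitian_recipAt_of_Ioo (a := -1) (b := 0) (by norm_num)
      (fun t ht => hreg t ⟨ht.1, ht.2.trans zero_le_one⟩)
      (fun t ht => hne t (abs_lt.2 ⟨ht.1, ht.2.trans zero_lt_one⟩) ht.2.ne) ⟨hx.1, h⟩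
  · exact isHermitian_recipAt_of_Ioo (a := 0) (b := 1) (by norm_num)
      (fun t ht => hreg t ⟨by linarith [ht.1], ht.2⟩)
      (fun t ht => hne t (abs_lt.2 ⟨by linarith [ht.1], ht.2⟩) ht.1.ne') ⟨h, hx.2⟩

lemma IsDNI.monotoneOn_quadForm (hP : P.IsDNI) (hprop : P.IsProper) (h1 : ¬ P.IsPole 1)
    (h2 : ¬ P.IsPole (-1)) (v : Fin m → ℂ) :
    MonotoneOn (fun t : ℝ => ((P.recipAt (t : ℂ)).quadForm v).re) (Icc (-1) 1) :=
  Complex.monotoneOn_re_of_im_nonpos (h := fun x => (P.recipAt x).quadForm v)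
    (fun _ hx => differentiableAt_quadForm (hP.regularAt_real h1 h2 hx) v)
    (fun _ hx => (hP.isHermitian_recipAt hprop h1 h2 hx).quadForm_im v)
    (fun _ hx him => hP.im_quadForm_nonpos hprop hx him v)

/-- The D-WSNI condition gives the sign only on the open arc. Symmetry of `Q` makes the form real on
the diameter, and the minimum principle then covers the interior. -/
lemma IsDWSNI.im_quadForm_neg (hQ : Q.IsDWSNI) (hprop : Q.IsProper) (hsymm : Q.IsSymm) {x : ℂ}
    (hx : ‖x‖ ≤ 1) (him : x.im < 0) {v : Fin m → ℂ} (hv : v ≠ 0) :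
    ((Q.recipAt x).quadForm v).im < 0 :=
  Complex.im_neg_of_lower_half_disc (h := fun x => (Q.recipAt x).quadForm v)
    (fun _ hx => differentiableAt_quadForm (hQ.regularAt hx) v)
    (fun _ _ him => (isHermitian_recipAt_of_isSymm hsymm him).quadForm_im v)
    (fun _ hx him => hQ.im_quadForm_neg_circle hprop hx him hv) hx him

lemma IsDWSNI.strictMonoOn_quadForm (hQ : Q.IsDWSNI) (hprop : Q.IsProper) (hsymm : Q.IsSymm)
    {v : Fin m → ℂ} (hv : v ≠ 0) :
    StrictMonoOn (fun t : ℝ => ((Q.recipAt (t : ℂ)).quadForm v).re) (Icc (-1) 1) :=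
  Complex.strictMonoOn_re_of_im_neg (h := fun x => (Q.recipAt x).quadForm v)
    (fun _ hx => differentiableAt_quadForm (hQ.regularAt hx) v)
    (fun _ _ => (isHermitian_recipAt_of_isSymm hsymm (Complex.ofReal_im _)).quadForm_im v)
    (fun _ hx him => hQ.im_quadForm_neg hprop hsymm hx.le him hv)

/-- The form is nonnegative at `x = -1` and strictly increasing from there. -/
lemma IsDWSNI.posDef_recipAt (hQ : Q.IsDWSNI) (hprop : Q.IsProper) (hsymm : Q.IsSymm)
    (hneg : (Q.valueAt (-1)).PosSemidef) {x : ℝ} (hx : x ∈ Ioc (-1 : ℝ) 1) :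
    (Q.recipAt (x : ℂ)).PosDef := by
  refine (isHermitian_recipAt_of_isSymm hsymm (Complex.ofReal_im _)).posDef_of_re fun v hv => ?_
  have h1 := hQ.strictMonoOn_quadForm hprop hsymm hv (left_mem_Icc.2 (by norm_num))
    (Ioc_subset_Icc_self hx) hx.1
  have h2 := hneg.re_quadForm_nonneg v
  rw [← recipAt_inv hprop (by simp), inv_neg, inv_one] at h2
  simp only [Complex.ofReal_neg, Complex.ofReal_one] at h1
  exact h2.trans_lt h1

end TransferMatrix

/-! ### Norm bounds and the energy estimate for the loop -/

namespace Matrix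
variable {m : ℕ}

lemma norm_mulVec_le_sum_norm (A : Matrix (Fin m) (Fin m) ℂ) (v : Fin m → ℂ) :
    ‖A.mulVec v‖ ≤ (∑ i, ∑ j, ‖A i j‖) * ‖v‖ := by
  refine (pi_norm_le_iff_of_nonneg (by positivity)).2 fun i => ?_
  calc ‖A.mulVec v i‖ ≤ ∑ j, ‖A i j * v j‖ := by
        rw [Matrix.mulVec, dotProduct]
        exact norm_sum_le _ _
    _ ≤ ∑ j, ‖A i j‖ * ‖v‖ := Finset.sum_le_sum fun j _ => by
        rw [norm_mul]
        gcongr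
        exact norm_le_pi_norm v j
    _ = (∑ j, ‖A i j‖) * ‖v‖ := (Finset.sum_mul _ _ _).symm
    _ ≤ _ := by
        refine mul_le_mul_of_nonneg_right ?_ (norm_nonneg _)
        exact Finset.single_le_sum (f := fun i => ∑ j, ‖A i j‖)
          (fun _ _ => Finset.sum_nonneg fun _ _ => norm_nonneg _) (Finset.mem_univ i)

lemma norm_star_dotProduct_le (u v : Fin m → ℂ) : ‖star u ⬝ᵥ v‖ ≤ m * (‖u‖ * ‖v‖) := by
  calc ‖star u ⬝ᵥ v‖ ≤ ∑ i, ‖star u i * v i‖ := norm_sum_le _ _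
    _ ≤ ∑ _i : Fin m, ‖u‖ * ‖v‖ := Finset.sum_le_sum fun i _ => by
        rw [norm_mul, Pi.star_apply, norm_star]
        gcongr
        · exact norm_le_pi_norm u i
        · exact norm_le_pi_norm v i
    _ = _ := by simp

/-- An energy estimate for the feedback loop of `P` and `Q`. -/
lemma norm_le_of_loop {P Q : Matrix (Fin m) (Fin m) ℂ} {c β : ℝ} (hc : 0 < c)
    (hP : ∀ v, (P.quadForm v).im ≤ 0) (hQ : ∀ v, (Q.quadForm v).im ≤ -(c * ‖v‖ ^ 2))
    (hβ : ∑ i, ∑ j, ‖Q i j‖ ≤ β) {w₁ w₂ e₁ e₂ : Fin m → ℂ} (h₁ : e₁ = w₁ + Q.mulVec e₂)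
    (h₂ : e₂ = w₂ + P.mulVec e₁) :
    ‖e₂‖ ≤ (1 + m * (β + 2) / c) * (‖w₁‖ + ‖w₂‖) := by
  have hβ0 : 0 ≤ β := le_trans (by positivity) hβ
  have hi₂ : (star e₁ ⬝ᵥ e₂).im = (star e₁ ⬝ᵥ w₂).im + (P.quadForm e₁).im := by
    rw [quadForm, ← Complex.add_im, ← dotProduct_add, ← h₂]
  have hi₁ : (star e₂ ⬝ᵥ e₁).im = (star e₂ ⬝ᵥ w₁).im + (Q.quadForm e₂).im := by
    rw [quadForm, ← Complex.add_im, ← dotProduct_add, ← h₁]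
  -- The two cross terms cancel when the loop identities are added, so the strict negativity of `Q`
  -- alone controls `‖e₂‖ ^ 2`.
  have hsum : (star e₁ ⬝ᵥ e₂).im = -(star e₂ ⬝ᵥ e₁).im := by
    rw [star_dotProduct_comm, Complex.conj_im]
  have hb₂ := (Complex.abs_im_le_norm _).trans (norm_star_dotProduct_le e₁ w₂)
  have hb₁ := (Complex.abs_im_le_norm _).trans (norm_star_dotProduct_le e₂ w₁)
  have he₁ : ‖e₁‖ ≤ ‖w₁‖ + β * ‖e₂‖ := by
    rw [h₁]
    refine (norm_add_le _ _).trans ?_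
    gcongr
    exact (norm_mulVec_le_sum_norm _ _).trans (by gcongr)
  have hmain : c * ‖e₂‖ ^ 2 ≤ m * (‖e₁‖ * ‖w₂‖) + m * (‖e₂‖ * ‖w₁‖) := by
    linarith [hP e₁, hQ e₂, le_abs_self (star e₁ ⬝ᵥ w₂).im, le_abs_self (star e₂ ⬝ᵥ w₁).im]
  set W := ‖w₁‖ + ‖w₂‖ with hW
  set E := ‖e₂‖ with hE
  have hE0 : 0 ≤ E := norm_nonneg _
  have hw₁ : ‖w₁‖ ≤ W := le_add_of_nonneg_right (norm_nonneg _)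
  have hw₂ : ‖w₂‖ ≤ W := le_add_of_nonneg_left (norm_nonneg _)
  have hW0 : 0 ≤ W := (norm_nonneg _).trans hw₁
  have hK : 0 ≤ m * (β + 2) / c := by positivity
  -- If `E ≤ W`, the summand `1` of the constant suffices. If `W ≤ E`, then `‖e₁‖ ≤ (1 + β) E`, and
  -- one factor `E` can be divided out; `β + 2` is `(1 + β) + 1`.
  rcases le_total E W with h | h
  · nlinarith
  · have h3 : c * E ^ 2 ≤ (m * (β + 2) * W) * E := by
      calc c * E ^ 2 ≤ m * (‖e₁‖ * ‖w₂‖) + m * (E * ‖w₁‖) := hmain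
        _ ≤ m * ((E + β * E) * W) + m * (E * W) := by
            gcongr
            exact he₁.trans (by linarith)
        _ = _ := by ring
    rcases hE0.eq_or_lt with h0 | h0
    · rw [← h0]; positivity
    · have h4 : c * E ≤ m * (β + 2) * W := by
        refine le_of_mul_le_mul_right ?_ h0
        linarith
      have h5 : E ≤ m * (β + 2) / c * W := by
        rw [div_mul_eq_mul_div, le_div_iff₀ hc]
        linarith
      linarith

lemma det_one_sub_smul_ne_zero {A : Matrix (Fin m) (Fin m) ℂ} (hA : ∑ i, ∑ j, ‖A i j‖ < 1)
    {s : ℝ} (hs : s ∈ Icc (0 : ℝ) 1) : (1 - (s : ℂ) • A).det ≠ 0 := by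
  intro hdet
  obtain ⟨v, hv0, hv⟩ := exists_mulVec_eq_zero_iff.2 hdet
  rw [sub_mulVec, one_mulVec, smul_mulVec, sub_eq_zero] at hv
  have hn : 0 < ‖v‖ := norm_pos_iff.2 hv0
  have h1 : ‖v‖ ≤ ‖A.mulVec v‖ := by
    calc ‖v‖ = |s| * ‖A.mulVec v‖ := by
          conv_lhs => rw [hv]
          rw [norm_smul, Complex.norm_real, Real.norm_eq_abs]
      _ ≤ _ := mul_le_of_le_one_left (norm_nonneg _) (by rw [abs_of_nonneg hs.1]; exact hs.2)
  have h2 := norm_mulVec_le_sum_norm A v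
  nlinarith

end Matrix

/-! ### Stability from nonsingularity on the real segment -/

namespace TransferMatrix
variable {m : ℕ} {P Q : TransferMatrix m}

/-- Near a point of the lower half of the closed unit disc, the quadratic form of a strictly
negative imaginary transfer matrix is radially bounded away from the real axis. -/
lemma IsDWSNI.exists_radial_bound (hQ : Q.IsDWSNI) (hprop : Q.IsProper) (hsymm : Q.IsSymm) {x : ℂ}
    (hx : ‖x‖ ≤ 1) (him : x.im < 0) : ∃ c : ℝ, 0 < c ∧ ∀ᶠ t : ℝ in 𝓝 1, ∀ v : Fin m → ℂ,
      ((Q.recipAt (t * x)).quadForm v).im ≤ -(c * ‖v‖ ^ 2) := by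
  have hlimx : Tendsto (fun t : ℝ => (t : ℂ) * x) (𝓝 1) (𝓝 x) := by
    have hc : Continuous fun t : ℝ => (t : ℂ) * x := by fun_prop
    simpa using hc.tendsto 1
  have hreg := hQ.regularAt hx
  have hK := isCompact_sphere (0 : Fin m → ℂ) 1
  have hform : Continuous fun v : Fin m → ℂ => -((Q.recipAt x).quadForm v).im := by
    simp only [Matrix.quadForm_eq_sum]
    fun_prop
  obtain ⟨c, hc0, hc⟩ := hK.exists_forall_le' hform.continuousOn (a := 0) fun v hv => by
    have hv0 : v ≠ 0 := by
      rintro rfl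
      simp at hv
    linarith [hQ.im_quadForm_neg hprop hsymm hx him hv0]
  -- `c` bounds the form on the unit sphere at `x` itself; half of it survives for `t` near `1`,
  -- uniformly on the compact sphere.
  refine ⟨c / 2, half_pos hc0, ?_⟩
  have hev : ∀ᶠ t : ℝ in 𝓝 1, ∀ v ∈ Metric.sphere (0 : Fin m → ℂ) 1,
      ((Q.recipAt (t * x)).quadForm v).im < -(c / 2) := by
    refine hK.eventually_forall_of_forall_eventually fun v hv => ?_
    have hcont : ContinuousAt
        (fun p : ℝ × (Fin m → ℂ) => ((Q.recipAt (p.1 * x)).quadForm p.2).im) (1, v) := by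
      refine Complex.continuous_im.continuousAt.comp ?_
      simp only [Matrix.quadForm_eq_sum]
      refine tendsto_finsetSum _ fun i _ => ContinuousAt.mul (by fun_prop) ?_
      refine tendsto_finsetSum _ fun j _ => ContinuousAt.mul ?_ (by fun_prop)
      have h1 : Tendsto (fun p : ℝ × (Fin m → ℂ) => (p.1 : ℂ) * x) (𝓝 (1, v)) (𝓝 x) :=
        hlimx.comp (continuous_fst.tendsto _)
      have h2 := ((differentiableAt_recipAt hreg i j).continuousAt.tendsto).comp h1
      simpa [ContinuousAt, Function.comp_def] using h2
    refine hcont.eventually_lt continuousAt_const ?_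
    have := hc v hv
    simp only [Complex.ofReal_one, one_mul]
    linarith
  filter_upwards [hev] with t ht v
  rcases eq_or_ne v 0 with rfl | hv
  · simp [Matrix.quadForm]
  have hn : 0 < ‖v‖ := norm_pos_iff.2 hv
  have h1 := ht (((‖v‖⁻¹ : ℝ) : ℂ) • v) (by
    simp only [mem_sphere_zero_iff_norm, norm_smul, Complex.norm_real, norm_inv, norm_norm]
    exact inv_mul_cancel₀ hn.ne')
  rw [Matrix.quadForm_smul, Complex.im_ofReal_mul, Complex.norm_real, norm_inv, norm_norm,
    inv_pow, inv_mul_lt_iff₀ (by positivity)] at h1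
  linarith

/-- A uniform radial bound on the loop near a point of the lower half of the closed disc. -/
lemma exists_loop_bound (hPproper : P.IsProper) (hP : P.IsDNI) (hQproper : Q.IsProper)
    (hQsymm : Q.IsSymm) (hQ : Q.IsDWSNI) {x : ℂ} (hx : ‖x‖ ≤ 1) (him : x.im < 0) :
    ∃ K : ℝ, ∀ᶠ t : ℝ in 𝓝[<] 1, ‖(t : ℂ) * x‖ < 1 ∧ ∀ w₁ w₂ e₁ e₂ : Fin m → ℂ,
      e₁ = w₁ + (Q.recipAt (t * x)).mulVec e₂ → e₂ = w₂ + (P.recipAt (t * x)).mulVec e₁ →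
        ‖e₂‖ ≤ K * (‖w₁‖ + ‖w₂‖) := by
  obtain ⟨c, hc0, hc⟩ := hQ.exists_radial_bound hQproper hQsymm hx him
  set β := (∑ i, ∑ j, ‖Q.recipAt x i j‖) + 1 with hβ
  have hlimx : Tendsto (fun t : ℝ => (t : ℂ) * x) (𝓝 1) (𝓝 x) := by
    have hc : Continuous fun t : ℝ => (t : ℂ) * x := by fun_prop
    simpa using hc.tendsto 1
  have hβev : ∀ᶠ t : ℝ in 𝓝 1, ∑ i, ∑ j, ‖Q.recipAt (t * x) i j‖ < β := by
    have hlim : Tendsto (fun t : ℝ => ∑ i, ∑ j, ‖Q.recipAt (t * x) i j‖) (𝓝 1)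
        (𝓝 (∑ i, ∑ j, ‖Q.recipAt x i j‖)) :=
      tendsto_finsetSum _ fun i _ => tendsto_finsetSum _ fun j _ =>
        (((differentiableAt_recipAt (hQ.regularAt hx) i j).continuousAt.tendsto).comp hlimx).norm
    exact hlim.eventually_lt_const (lt_add_one _)
  refine ⟨1 + m * (β + 2) / c, ?_⟩
  filter_upwards [nhdsWithin_le_nhds hc, nhdsWithin_le_nhds hβev, self_mem_nhdsWithin,
    nhdsWithin_le_nhds (lt_mem_nhds zero_lt_one)] with t h1 h2 h3 h4
  have h3 : t < 1 := h3
  have hlt : ‖(t : ℂ) * x‖ < 1 := by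
    rw [norm_mul, Complex.norm_real, Real.norm_eq_abs, abs_of_pos h4]
    nlinarith [norm_nonneg x]
  have him' : ((t : ℂ) * x).im < 0 := by
    rw [Complex.im_ofReal_mul]
    exact mul_neg_of_pos_of_neg h4 him
  exact ⟨hlt, fun w₁ w₂ e₁ e₂ he₁ he₂ =>
    Matrix.norm_le_of_loop hc0 (hP.im_quadForm_nonpos hPproper hlt him') h1 h2.le he₁ he₂⟩

/-- Evaluation of a polynomial matrix. -/
noncomputable def evalMatrix (A : Matrix (Fin m) (Fin m) ℝ[X]) (x : ℂ) : Matrix (Fin m) (Fin m) ℂ :=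
  A.map (Polynomial.aeval x)

lemma evalMatrix_mul (A B : Matrix (Fin m) (Fin m) ℝ[X]) (x : ℂ) :
    evalMatrix (A * B) x = evalMatrix A x * evalMatrix B x :=
  Matrix.map_mul

lemma evalMatrix_smul (p : ℝ[X]) (A : Matrix (Fin m) (Fin m) ℝ[X]) (x : ℂ) :
    evalMatrix (p • A) x = p.aeval x • evalMatrix A x := by
  ext i j
  simp [evalMatrix]

lemma evalMatrix_adjugate (A : Matrix (Fin m) (Fin m) ℝ[X]) (x : ℂ) :
    evalMatrix A x * evalMatrix A.adjugate x = A.det.aeval x • 1 := by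
  rw [← evalMatrix_mul, Matrix.mul_adjugate, evalMatrix_smul]
  congr 1
  ext i j
  rw [evalMatrix, Matrix.map_apply, Matrix.one_apply, Matrix.one_apply]
  split_ifs <;> simp

lemma evalMatrix_commonNum {x : ℂ} (hP : P.RegularAt x) :
    evalMatrix P.commonNum x = P.commonDen.aeval x • P.recipAt x := by
  ext i j
  exact aeval_commonNum hP i j

lemma one_sub_mul_eq_of_loopMatrix {x : ℂ} (hP : P.RegularAt x) (hQ : Q.RegularAt x)
    {A B : Matrix (Fin m) (Fin m) ℂ}
    (h : evalMatrix (loopMatrix P Q) x * A = ((P.commonDen * Q.commonDen).aeval x) • B) :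
    (1 - P.recipAt x * Q.recipAt x) * A = B := by
  have hne : (P.commonDen * Q.commonDen).aeval x ≠ 0 := by
    rw [map_mul]
    exact mul_ne_zero (aeval_commonDen_ne_zero hP) (aeval_commonDen_ne_zero hQ)
  rw [evalMatrix, loopMatrix_map_aeval hP hQ, Matrix.smul_mul] at h
  exact smul_right_injective _ hne h

lemma norm_col_le {A : Matrix (Fin m) (Fin m) ℂ} (i j : Fin m) :
    ‖A i j‖ ≤ ‖A.mulVec (Pi.single j 1)‖ := by
  rw [Matrix.mulVec_single_one]
  exact norm_le_pi_norm (A.col j) i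

lemma norm_smul_single (δ : ℂ) (j : Fin m) : ‖(δ • Pi.single j 1 : Fin m → ℂ)‖ = ‖δ‖ := by
  rw [norm_smul, Pi.norm_single, norm_one, mul_one]

/-- Closed-loop stability from nonsingularity of `I - P Q` on the real segment. -/
theorem internallyStable_of_det_ne_zero (hPproper : P.IsProper) (hP : P.IsDNI)
    (hP1 : ¬ P.IsPole 1) (hP2 : ¬ P.IsPole (-1)) (hQproper : Q.IsProper)
    (hQsymm : Q.IsSymm) (hQ : Q.IsDWSNI)
    (hdet : ∀ x ∈ Icc (-1 : ℝ) 1, (1 - P.recipAt (x : ℂ) * Q.recipAt (x : ℂ)).det ≠ 0) :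
    InternallyStable P Q := by
  have hQreal : ∀ x ∈ Icc (-1 : ℝ) 1, Q.RegularAt (x : ℂ) := fun x hx =>
    hQ.regularAt (by simpa using abs_le.2 hx)
  have hdet' : ∀ x ∈ Icc (-1 : ℝ) 1, (loopMatrix P Q).det.aeval (x : ℂ) ≠ 0 := fun x hx h =>
    hdet x hx ((aeval_det_loopMatrix_eq_zero_iff (hP.regularAt_real hP1 hP2 hx)
      (hQreal x hx)).1 h)
  have h0 : (loopMatrix P Q).det.coeff 0 ≠ 0 := by
    intro h
    refine hdet' 0 (by simp) ?_
    rw [Complex.ofReal_zero, Polynomial.aeval_def, Polynomial.eval₂_at_zero, h, map_zero]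
  have hreal : ∀ x : ℂ, ‖x‖ ≤ 1 → x.im ≤ 0 → (loopMatrix P Q).det.aeval x = 0 → x.im < 0 := by
    intro x hx him hroot
    refine lt_of_le_of_ne him fun h => ?_
    have hx' : ((x.re : ℝ) : ℂ) = x := Complex.ext rfl (by simp [h])
    refine hdet' x.re (abs_le.1 ((Complex.abs_re_le_norm x).trans hx)) ?_
    rw [hx', hroot]
  refine internallyStable_of_absSummable h0 (fun i j => ?_) (fun i j => ?_) fun i j => ?_
  · exact PowerSeries.AbsSummable.mul_inv_of_no_root _ _ fun x hx => hQ.regularAt hx i j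
  -- A root of the determinant on the circle may come merely from a pole of `P`. Approaching it
  -- along the radius stays in the open disc, where `P` is regular.
  · refine PowerSeries.AbsSummable.mul_inv_of_radially_bounded _ _ h0 fun x hx him hroot => ?_
    obtain ⟨K, hK⟩ := exists_loop_bound hPproper hP hQproper hQsymm hQ hx (hreal x hx him hroot)
    refine ⟨K, ?_⟩
    filter_upwards [hK] with t ⟨hlt, ht⟩
    set y : ℂ := (t : ℂ) * x
    have hPr := hP.regularAt hlt
    have hQr := hQ.regularAt hlt.le
    set A := (loopMatrix P Q).adjugate * (Q.commonDen • P.commonNum) with hA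
    set δ := (loopMatrix P Q).det.aeval y with hδ
    have hmul : (1 - P.recipAt y * Q.recipAt y) * evalMatrix A y = δ • P.recipAt y := by
      refine one_sub_mul_eq_of_loopMatrix hPr hQr ?_
      rw [hA, evalMatrix_mul, ← Matrix.mul_assoc, evalMatrix_adjugate, evalMatrix_smul,
        evalMatrix_commonNum hPr, Matrix.smul_mul, Matrix.one_mul, smul_smul, smul_smul, smul_smul,
        map_mul]
      congr 1
      ring
    -- Column `j` of `A` is the signal `e₂` of the loop driven by `w₁ = δ • Pi.single j 1` and `w₂ =
    -- 0`, so the loop bound is exactly the radial bound by `K ‖δ‖`.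
    have hbd := ht (δ • Pi.single j 1) 0 _ ((evalMatrix A y).mulVec (Pi.single j 1)) rfl (by
      have := congrArg (fun B => B.mulVec (Pi.single j (1 : ℂ))) hmul
      simp only [← Matrix.mulVec_mulVec, Matrix.sub_mulVec, Matrix.one_mulVec,
        Matrix.smul_mulVec] at this
      rw [zero_add, Matrix.mulVec_add, Matrix.mulVec_smul, ← this]
      abel)
    rw [norm_smul_single, norm_zero, add_zero] at hbd
    exact (norm_col_le (A := evalMatrix A y) i j).trans hbd
  · refine PowerSeries.AbsSummable.mul_inv_of_radially_bounded _ _ h0 fun x hx him hroot => ?_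
    obtain ⟨K, hK⟩ := exists_loop_bound hPproper hP hQproper hQsymm hQ hx (hreal x hx him hroot)
    refine ⟨K, ?_⟩
    filter_upwards [hK] with t ⟨hlt, ht⟩
    set y : ℂ := (t : ℂ) * x
    have hPr := hP.regularAt hlt
    have hQr := hQ.regularAt hlt.le
    set A := (P.commonDen * Q.commonDen) • (loopMatrix P Q).adjugate with hA
    set δ := (loopMatrix P Q).det.aeval y with hδ
    have hmul : (1 - P.recipAt y * Q.recipAt y) * evalMatrix A y =
        δ • (1 : Matrix (Fin m) (Fin m) ℂ) := by
      refine one_sub_mul_eq_of_loopMatrix hPr hQr ?_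
      rw [hA, evalMatrix_smul, Matrix.mul_smul, evalMatrix_adjugate]
    -- The same argument with the drive entering at `w₂`.
    have hbd := ht 0 (δ • Pi.single j 1) _ ((evalMatrix A y).mulVec (Pi.single j 1)) rfl (by
      have := congrArg (fun B => B.mulVec (Pi.single j (1 : ℂ))) hmul
      simp only [← Matrix.mulVec_mulVec, Matrix.sub_mulVec, Matrix.one_mulVec,
        Matrix.smul_mulVec] at this
      rw [zero_add, ← this]
      abel)
    rw [norm_smul_single, norm_zero, zero_add] at hbd
    exact (norm_col_le (A := evalMatrix A y) i j).trans hbd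

lemma aeval_ofReal_ne_zero_iff (p : ℝ[X]) (x : ℝ) : p.aeval (x : ℂ) ≠ 0 ↔ p.eval x ≠ 0 := by
  have h : p.aeval (x : ℂ) = ((p.eval x : ℝ) : ℂ) := by
    have := Polynomial.aeval_algebraMap_apply ℂ x p
    simpa using this
  rw [h, Complex.ofReal_ne_zero]

lemma InternallyStable.det_ne_zero (h : InternallyStable P Q) {x : ℝ} (hx : x ∈ Icc (-1 : ℝ) 1)
    (hP : P.RegularAt (x : ℂ)) (hQ : Q.RegularAt (x : ℂ)) :
    (1 - P.recipAt (x : ℂ) * Q.recipAt (x : ℂ)).det ≠ 0 := by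
  rw [ne_eq, ← aeval_det_loopMatrix_eq_zero_iff hP hQ, ← ne_eq, aeval_ofReal_ne_zero_iff]
  refine h.eval_det_loopMatrix_ne_zero (abs_le.2 hx) ?_
  rw [← aeval_ofReal_ne_zero_iff, map_mul]
  exact mul_ne_zero (aeval_commonDen_ne_zero hP) (aeval_commonDen_ne_zero hQ)

end TransferMatrix

/-! ### The eigenvalue criterion -/

theorem mainTheorem4 (m : ℕ) (hm : 0 < m) (P Q : TransferMatrix m)
    (hPproper : P.IsProper) (hP : P.IsDNI)
    (hPpos : ¬ P.IsPole 1) (hPneg : ¬ P.IsPole (-1))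
    (hQproper : Q.IsProper) (hQsymm : Q.IsSymm) (hQ : Q.IsDWSNI)
    (hPQ : P.valueAt (-1) * Q.valueAt (-1) = 0)
    (hQneg : (Q.valueAt (-1)).PosSemidef) :
    HasOnlyRealEigenvalues (P.valueAt 1 * Q.valueAt 1) ∧
      (TransferMatrix.InternallyStable P Q ↔
        largestEigenvalue (P.valueAt 1 * Q.valueAt 1) < 1) := by
  have hPreg : ∀ x ∈ Icc (-1 : ℝ) 1, P.RegularAt (x : ℂ) := fun x hx =>
    hP.regularAt_real hPpos hPneg hx
  have hQreg : ∀ x ∈ Icc (-1 : ℝ) 1, Q.RegularAt (x : ℂ) := fun x hx =>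
    hQ.regularAt (by simpa using abs_le.2 hx)
  have hPH : ∀ x ∈ Icc (-1 : ℝ) 1, (P.recipAt (x : ℂ)).IsHermitian := fun x hx =>
    hP.isHermitian_recipAt hPproper hPpos hPneg hx
  have hQpd : ∀ x ∈ Ioc (-1 : ℝ) 1, (Q.recipAt (x : ℂ)).PosDef := fun x hx =>
    hQ.posDef_recipAt hQproper hQsymm hQneg hx
  have hP1 : P.valueAt 1 = P.recipAt ((1 : ℝ) : ℂ) := by
    rw [Complex.ofReal_one, TransferMatrix.recipAt_eq hPproper one_ne_zero, inv_one]
  have hQ1 : Q.valueAt 1 = Q.recipAt ((1 : ℝ) : ℂ) := by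
    rw [Complex.ofReal_one, TransferMatrix.recipAt_eq hQproper one_ne_zero, inv_one]
  have hPQ' : P.recipAt ((-1 : ℝ) : ℂ) * Q.recipAt ((-1 : ℝ) : ℂ) = 0 := by
    rw [TransferMatrix.recipAt_eq hPproper (by simp), TransferMatrix.recipAt_eq hQproper (by simp)]
    simpa [inv_neg] using hPQ
  have hone : (1 : ℝ) ∈ Icc (-1 : ℝ) 1 := ⟨by norm_num, le_rfl⟩
  have hone' : (1 : ℝ) ∈ Ioc (-1 : ℝ) 1 := ⟨by norm_num, le_rfl⟩
  rw [hP1, hQ1]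
  have hspecreal : HasOnlyRealEigenvalues (P.recipAt ((1 : ℝ) : ℂ) * Q.recipAt ((1 : ℝ) : ℂ)) := by
    intro μ hμ
    obtain ⟨v, hv0, hv⟩ := Matrix.mem_spectrum_iff_exists_mulVec.1 hμ
    exact (hQpd 1 hone').eigenvalue_mul_im (hPH 1 hone) hv0 hv
  refine ⟨hspecreal, ?_⟩
  have hlargest : largestEigenvalue (P.recipAt ((1 : ℝ) : ℂ) * Q.recipAt ((1 : ℝ) : ℂ)) < 1 ↔
      ∀ μ : ℝ, (μ : ℂ) ∈ spectrum ℂ (P.recipAt ((1 : ℝ) : ℂ) * Q.recipAt ((1 : ℝ) : ℂ)) →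
        μ < 1 := by
    -- The supremum is a genuine maximum because the set of real eigenvalues is finite and, as `0 <
    -- m` and all eigenvalues are real, nonempty.
    refine Set.Finite.csSup_lt_iff ?_ ?_
    · exact (Matrix.finite_spectrum _).preimage Complex.ofReal_injective.injOn
    · have : Nonempty (Fin m) := ⟨⟨0, hm⟩⟩
      obtain ⟨μ, hμ⟩ := spectrum.nonempty_of_isAlgClosed_of_finiteDimensional ℂ
        (P.recipAt ((1 : ℝ) : ℂ) * Q.recipAt ((1 : ℝ) : ℂ))
      refine ⟨μ.re, ?_⟩
      have hre : ((μ.re : ℝ) : ℂ) = μ := Complex.ext rfl (by simp [hspecreal μ hμ])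
      rwa [mem_ofPred_eq, hre]
  rw [hlargest]
  constructor
  · intro hstab μ hμ
    obtain ⟨v, hv0, hv⟩ := Matrix.mem_spectrum_iff_exists_mulVec.1 hμ
    refine (hQpd 1 hone').eigenvalue_mul_lt_one ?_ hv0 hv
    have hcontP : ContinuousOn (fun x : ℝ => P.recipAt (x : ℂ)) (Icc (-1) 1) := fun x hx =>
      (ContinuousAt.comp (f := fun t : ℝ => (t : ℂ))
        (TransferMatrix.continuousAt_recipAt (hPreg x hx))
        Complex.continuous_ofReal.continuousAt).continuousWithinAt
    have hcontQ : ContinuousOn (fun x : ℝ => Q.recipAt (x : ℂ)) (Icc (-1) 1) := fun x hx =>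
      (ContinuousAt.comp (f := fun t : ℝ => (t : ℂ))
        (TransferMatrix.continuousAt_recipAt (hQreg x hx))
        Complex.continuous_ofReal.continuousAt).continuousWithinAt
    -- The path starts slightly to the right of `-1`, since `Q(-1)` may be singular. There `P Q` is
    -- still small by continuity, so `Q - Q P Q` is positive definite.
    obtain ⟨a, ha, hsmall⟩ : ∃ a ∈ Ioo (-1 : ℝ) 1,
        ∑ i, ∑ j, ‖(P.recipAt (a : ℂ) * Q.recipAt (a : ℂ)) i j‖ < 1 := by
      have hc : ContinuousOn
          (fun x : ℝ => ∑ i, ∑ j, ‖(P.recipAt (x : ℂ) * Q.recipAt (x : ℂ)) i j‖) (Icc (-1) 1) :=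
        continuousOn_finsetSum _ fun i _ => continuousOn_finsetSum _ fun j _ =>
          ((continuous_apply_apply i j).comp_continuousOn (hcontP.mul hcontQ)).norm
      have hlim := (hc (-1) ⟨le_rfl, by norm_num⟩).mono_left
        (nhdsWithin_mono _ (Ioo_subset_Icc_self (a := (-1 : ℝ)) (b := 1)))
      have hne : (𝓝[Ioo (-1 : ℝ) 1] (-1)).NeBot := by
        rw [nhdsWithin_Ioo_eq_nhdsGT (by norm_num)]
        infer_instance
      have hev :=
        (hlim.eventually_lt_const (u := 1) (by simp only [hPQ']; simp)).and self_mem_nhdsWithin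
      obtain ⟨a, h1, h2⟩ := hev.exists
      exact ⟨a, h2, h1⟩
    have hsub : Icc a 1 ⊆ Ioc (-1 : ℝ) 1 := fun x hx => ⟨ha.1.trans_le hx.1, hx.2⟩
    have hsub' : Icc a 1 ⊆ Icc (-1 : ℝ) 1 := hsub.trans Ioc_subset_Icc_self
    have hstart := (hQpd a ⟨ha.1, ha.2.le⟩).sub_mul_mul_of_det_ne_zero (hPH a ⟨ha.1.le, ha.2.le⟩)
      fun s hs => Matrix.det_one_sub_smul_ne_zero hsmall hs
    -- From `a` to `1` the determinant is `det Q · det (1 - P Q)`, whose second factor is nonzero by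
    -- stability.
    refine Matrix.PosDef.of_path (f := fun x : ℝ => Q.recipAt (x : ℂ) -
      Q.recipAt (x : ℂ) * P.recipAt (x : ℂ) * Q.recipAt (x : ℂ)) ha.2.le ?_ (fun x hx => ?_)
      (fun x hx => ?_) hstart
    · exact (hcontQ.sub ((hcontQ.mul hcontP).mul hcontQ)).mono hsub'
    · simpa using (hQpd x (hsub hx)).1.sub_smul_mul_mul (hPH x (hsub' hx)) 1
    · have := Matrix.det_sub_smul_mul_mul (P := P.recipAt (x : ℂ)) (Q := Q.recipAt (x : ℂ)) 1
      rw [one_smul, one_smul] at this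
      rw [this]
      exact mul_ne_zero (ne_of_gt (hQpd x (hsub hx)).det_pos)
        (hstab.det_ne_zero (hsub' hx) (hPreg x (hsub' hx)) (hQreg x (hsub' hx)))
  · intro hlt
    have hH := (hQpd 1 hone').sub_mul_mul_of_eigenvalue_lt_one (hPH 1 hone) hlt
    refine TransferMatrix.internallyStable_of_det_ne_zero hPproper hP hPpos hPneg hQproper hQsymm
      hQ fun x hx => ?_
    rcases hx.1.eq_or_lt with rfl | hx1
    · rw [hPQ', sub_zero, Matrix.det_one]
      exact one_ne_zero
    · refine Matrix.det_one_sub_mul_ne_zero_of_le (hQpd 1 hone') hH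
        (hQpd x ⟨hx1, hx.2⟩).posSemidef
        (fun v => hP.monotoneOn_quadForm hPproper hPpos hPneg v hx hone hx.2) fun v => ?_
      rcases eq_or_ne v 0 with rfl | hv
      · simp [Matrix.quadForm]
      · exact (hQ.strictMonoOn_quadForm hQproper hQsymm hv).monotoneOn hx hone hx.2
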